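/- Let $L,m,\beta>0$, let $\mathbb T^1$ be the circle of circumference $L$ with Lebesgue measure $dx$ (total mass $L$), let $\Omega=C(\mathbb T^1,\mathbb C)$ with the uniform topology and its Borel $\sigma$-algebra, and write $\|\cdot\|_q$ for the norm of $L^q(\mathbb T^1)$. For $k\in\mathbb Z$ put $u_k(x)=L^{-1/2}e^{2\pi i kx/L}$ and $X_k(\varphi)=\int_{\mathbb T^1}\overline{u_k}\,\varphi\,dx$. Let $\mu_\beta$ be the Gaussian measure on $\Omega$ with mean zero and covariance $\beta^{-1}(m^2-\Delta)^{-1}$ with respect to the real inner product $\mathrm{Re}\int\overline{\varphi}\,\psi\,dx$, i.e. the measure on $\Omega$ under which the $X_k$, $k\in\mathbb Z$, are independent and $X_k$ has on $\mathbb C\cong\mathbb R^2$ the density $\frac{\theta_k}{2\pi}e^{-\theta_k|z|^2/2}$, where $\theta_k=\beta\,(m^2+(2\pi k/L)^2)$. (If $P$ denotes the product of these laws on $\mathbb C^{\mathbb Z}$, then $\mu_\beta(A)=P(\{(X_k(\varphi))_k:\varphi\in A\})$ for Borel $A\subseteq\Omega$.) For real $\gamma$, the domain of $(m^2-\Delta)^\gamma$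 is $\{\varphi:\sum_k (m^2+(2\pi k/L)^2)^{2\gamma}|X_k(\varphi)|^2<\infty\}$, and there $(m^2-\Delta)^\gamma\varphi=\sum_k (m^2+(2\pi k/L)^2)^{\gamma}X_k(\varphi)u_k$, with convergence in $L^2(\mathbb T^1)$. **Theorem 3.2.** The measure $\mu_\beta$ is a probability measure on $\Omega$, and the following hold. 1. Let $2<p<6$, $\lambda\in\mathbb R$, $\kappa>0$, and let $\alpha\in(0,\tfrac12)$ be such that $4\alpha+4-p>0$. If $$r>\frac{2\alpha p+2}{4\alpha+4-p},$$ then $$\int_\Omega e^{\frac{\lambda}{p}\|\varphi\|_p^p-\kappa\|\varphi\|_2^{2r}}\,d\mu_\beta(\varphi)<\infty .$$ In particular the generalized grand-canonical Gibbs measure $$d\widetilde\gamma_{\kappa,\beta,\lambda}=\frac1{\widetilde Z}\,e^{\beta\frac{\lambda}{p}\|\varphi\|_p^p-\beta\kappa\|\varphi\|_2^{2r}}\,d\mu_\beta,\qquad \widetilde Z=\int_\Omega e^{\beta\frac{\lambda}{p}\|\varphi\|_p^p-\beta\kappa\|\varphi\|_2^{2r}}\,d\mu_\beta,$$ is a well-defined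 probability measure on $\Omega$. 2. Let $\gamma<\tfrac18$. Then $\mu_\beta$-almost every $\varphi$ lies in the domain of $(m^2-\Delta)^\gamma$, and for all $\mu\in\mathbb R$, all $\kappa>0$ and all $r>9$, $$\int_\Omega \exp\left[\mu\left|\int_{\mathbb T^1}|\varphi|^2\,\overline{\varphi}\,(m^2-\Delta)^\gamma\varphi\,dx\right|-\kappa\|\varphi\|_2^{2r}\right]d\mu_\beta(\varphi)<\infty .$$ -/

import Mathlib

open MeasureTheory ProbabilityTheory
open scoped NNReal ENNReal ComplexConjugate

noncomputable section

namespace NLSGibbs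

/-- The space `Ω` of continuous complex-valued functions on the circle of circumference `L`, with
its uniform topology. -/
abbrev Omega (L : ℝ) : Type := C(AddCircle L, ℂ)

/-- `Ω` carries its Borel `σ`-algebra. -/
instance instMeasurableSpaceOmega (L : ℝ) : MeasurableSpace C(AddCircle L, ℂ) := borel _

instance instBorelSpaceOmega (L : ℝ) : BorelSpace C(AddCircle L, ℂ) := ⟨rfl⟩

/-- The orthonormal plane waves `u_k(x) = L^{-1/2} e^{2πikx/L}`, `k ∈ ℤ`. -/
def planeWave (L : ℝ) (k : ℤ) : Omega L := ((Real.sqrt L : ℂ)⁻¹) • fourier k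

/-- The eigenvalue `m² + (2πk/L)²` of `m² - Δ` on `u_k`. -/
def eigenvalue (L m : ℝ) (k : ℤ) : ℝ := m ^ 2 + (2 * Real.pi * k / L) ^ 2

section Circle

variable (L : ℝ) [Fact (0 < L)]

/-- The modes `X_k(φ) = ⟨u_k, φ⟩ = ∫ conj (u_k(x)) φ(x) dx` of `φ`. The measure `volume` on the
circle has total mass `L`. -/
def mode (φ : Omega L) (k : ℤ) : ℂ :=
  ∫ x : AddCircle L, conj (planeWave L k x) * φ x

/-- The law on `ℂ ≃ ℝ²` of a complex number whose real and imaginary parts are independent centred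
Gaussians of variance `1/θ`, that is, with the density `(θ / 2π) exp (-θ |x|² / 2)`. -/
def gaussianPlane (θ : ℝ) : Measure ℂ :=
  ((gaussianReal 0 (θ⁻¹).toNNReal).prod (gaussianReal 0 (θ⁻¹).toNNReal)).map
    Complex.measurableEquivRealProd.symm

instance instIsProbabilityMeasureGaussianPlane (θ : ℝ) :
    IsProbabilityMeasure (gaussianPlane θ) :=
  Measure.isProbabilityMeasure_map Complex.measurableEquivRealProd.symm.measurable.aemeasurable

/-- The joint law of the modes: independent Gaussians, the `k`-th one with `θ_k = β (m² + (2πk/L)²)`,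
the inverse of the eigenvalue on `u_k` of the covariance `C = β⁻¹ (m² - Δ)⁻¹`. -/
def modeLaw (m β : ℝ) : Measure (ℤ → ℂ) :=
  Measure.infinitePi fun k => gaussianPlane (β * eigenvalue L m k)

/-- The Gaussian measure `μ_β` on `Ω` with mean zero and covariance `C = β⁻¹ (m² - Δ)⁻¹`, that is,
the measure under which the modes `X_k` are independent with the laws above:
`μ_β A = modeLaw (X '' A)` for Borel sets `A`. (The map `X : Ω → ℂ^ℤ` is a measurable embedding,
see `measurableEmbedding_mode`, so the pullback is the genuine one.) -/
def refMeasure (m β : ℝ) : Measure (Omega L) :=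
  (modeLaw L m β).comap (mode L)

variable {L}

/-- The norm `‖φ‖_q = (∫ |φ(x)|^q dx)^{1/q}`. -/
def norm_q (q : ℝ) (φ : Omega L) : ℝ := lpNorm φ (ENNReal.ofReal q) volume

/-- `φ` lies in the domain of `(m² - Δ)^γ`: `∑_k (m² + (2πk/L)²)^{2γ} |X_k(φ)|² < ∞`. -/
def InDomain (m γ : ℝ) (φ : Omega L) : Prop :=
  Summable fun k : ℤ => eigenvalue L m k ^ (2 * γ) * ‖mode L φ k‖ ^ 2

/-- `(m² - Δ)^γ φ = ∑_k (m² + (2πk/L)²)^γ X_k(φ) u_k`, a series in `L²` of the circle that converges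
when `φ` lies in the domain of `(m² - Δ)^γ`. -/
def fracPow (m γ : ℝ) (φ : Omega L) : Lp ℂ 2 (volume : Measure (AddCircle L)) :=
  ∑' k : ℤ, (((eigenvalue L m k ^ γ : ℝ) : ℂ) * mode L φ k) •
    ContinuousMap.toLp (E := ℂ) 2 volume ℂ (planeWave L k)

/-- The quantity `∫ |φ|² conj(φ) (m² - Δ)^γ φ dx`. -/
def quarticPairing (m γ : ℝ) (φ : Omega L) : ℂ :=
  ∫ x : AddCircle L, (‖φ x‖ ^ 2 : ℝ) * conj (φ x) * fracPow m γ φ x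

variable (L)

/-- The generalized grand-canonical Gibbs measure
`Z⁻¹ exp (β (lam/p) ‖φ‖_p^p - β κ ‖φ‖_2^{2r}) dμ_β`, where `Z` is the integral of the exponential. -/
def gibbsMeasure (m β p lam κ r : ℝ) : Measure (Omega L) :=
  (refMeasure L m β).tilted fun φ =>
    β * (lam / p * norm_q p φ ^ p) - β * κ * norm_q 2 φ ^ (2 * r)

theorem continuous_mode : Continuous (mode L) := by
  refine continuous_pi fun k => ?_
  have h : (fun φ : Omega L => mode L φ k) = fun φ =>
      inner ℂ (ContinuousMap.toLp (E := ℂ) 2 (volume : Measure (AddCircle L)) ℂ (planeWave L k))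
        (ContinuousMap.toLp (E := ℂ) 2 (volume : Measure (AddCircle L)) ℂ φ) := by
    funext φ
    rw [ContinuousMap.inner_toLp]
    simp [mode, mul_comm]
  rw [h]
  fun_prop

theorem mode_eq_fourierCoeff (φ : Omega L) (k : ℤ) :
    mode L φ k = (Real.sqrt L : ℂ) * fourierCoeff φ k := by
  have hL : 0 < L := Fact.out
  have hs : (Real.sqrt L : ℂ) ≠ 0 := by
    exact_mod_cast (Real.sqrt_pos.2 hL).ne'
  have hs2 : (L : ℂ) = (Real.sqrt L : ℂ) * (Real.sqrt L : ℂ) := by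
    exact_mod_cast (Real.mul_self_sqrt hL.le).symm
  have h1 : mode L φ k = (Real.sqrt L : ℂ)⁻¹ * ∫ x : AddCircle L, fourier (-k) x • φ x := by
    rw [mode, ← integral_const_mul]
    congr 1
    funext x
    simp [planeWave, mul_assoc]
  rw [h1, fourierCoeff, AddCircle.integral_haarAddCircle]
  rw [Complex.real_smul]
  push_cast
  rw [hs2]
  field_simp

theorem injective_mode : Function.Injective (mode L) := by
  intro φ ψ h
  have hL : 0 < L := Fact.out
  have hs : (Real.sqrt L : ℂ) ≠ 0 := by
    exact_mod_cast (Real.sqrt_pos.2 hL).ne'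
  apply ContinuousMap.toLp_injective (p := 2) (𝕜 := ℂ) (AddCircle.haarAddCircle (T := L))
  apply fourierBasis.repr.injective
  ext k
  rw [fourierBasis_repr, fourierBasis_repr, fourierCoeff_toLp, fourierCoeff_toLp]
  have := congrFun h k
  rw [mode_eq_fourierCoeff, mode_eq_fourierCoeff] at this
  exact mul_left_cancel₀ hs this

theorem measurableEmbedding_mode : MeasurableEmbedding (mode L) :=
  (continuous_mode L).measurableEmbedding (injective_mode L)

/-- As soon as `μ_β` is a probability measure, the modes have under `μ_β` the law they should. -/
theorem map_mode_refMeasure (m β : ℝ) [IsProbabilityMeasure (refMeasure L m β)] :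
    (refMeasure L m β).map (mode L) = modeLaw L m β := by
  have he := measurableEmbedding_mode L
  have hP : IsProbabilityMeasure (modeLaw L m β) := by unfold modeLaw; infer_instance
  have h1 : modeLaw L m β (Set.range (mode L)) = 1 := by
    have h := measure_univ (μ := refMeasure L m β)
    rwa [refMeasure, he.comap_apply, Set.image_univ] at h
  rw [refMeasure, he.map_comap]
  refine Measure.restrict_eq_self_of_ae_mem ?_
  exact (prob_compl_eq_zero_iff he.measurableSet_range).2 h1

end Circle

end NLSGibbs

end

/-! Every integrability claim follows one scheme. Suppose `B ≥ 0` has a finite integral and,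
whenever `H ≥ 1` and `B φ ≤ exp (H²)`, the exponent satisfies `G φ ≤ H² + C`. The choice `H² = log
(e + B φ)` gives `exp (G φ) ≤ exp C * (e + B φ)`, which is integrable (`integrable_exp_of_le_sq`).
So it is enough to find a `B` for which `B φ ≤ exp (H²)` makes `φ` regular with a constant of order
`H`.

For Hölder regularity of order `α < 1/2`, `B` is `expIncr c σ` with `α < σ < 1/2`. Increments of the
Gaussian series have variance at most `V |x - y|^{2σ}`, because `∑ λ_k^{σ-1}` converges for the
eigenvalues `λ_k`, so for small `c` the mean of `B` is finite, uniformly over partial sums.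
Conversely, comparing averages over shrinking balls bounds the oscillation of `φ` at scale `h` by `C
H h^α`. Optimising `h` against the `L²` norm `n` gives `‖φ‖_∞ ≤ C (H^θ n^{1-θ} + n)` with `θ =
1/(2α+1)` (`exists_norm_le_interpolation`).

The measure has mass one because almost every mode sequence comes from a continuous function: by
Fatou, a subsequence of partial sums has bounded functional, hence uniform oscillation bounds;
together with convergence in `L²` these make it uniformly Cauchy (`exists_mode_eq`).

For the first claim, `‖φ‖_p^p ≤ ‖φ‖_∞^{p-2} n²` is bounded by monomials `H^a n^b`. Young's
inequality absorbs them into `H²` and `κ n^{2r}` when `a/2 + b/(2r) < 1`, which for the main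
monomial is the stated bound on `r`. For the second, Cauchy–Schwarz bounds the pairing by `‖φ‖_∞² n
‖(m²-Δ)^γ φ‖_2`. The last factor is at most of order `(H n)^{1/2}`, by interpolation with `∑
λ_k^{4γ} |X_k|²`, which `expModes` controls since `4γ < 1/2`. -/

noncomputable section

namespace NLSGibbs

open Filter Topology Set

/-! ### Exponential functional of the increments and comparison of means -/

section Increments

set_option linter.unusedSectionVars false

variable {L : ℝ} [Fact (0 < L)]

/-- The Garsia–Rodemich–Rumsey functional
`∫∫ exp (c |f(y) - f(z)|² / |y - z|^{2σ}) dy dz`. -/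
def expIncr (c σ : ℝ) (f : Omega L) : ℝ≥0∞ :=
  ∫⁻ z : AddCircle L × AddCircle L,
    ENNReal.ofReal (Real.exp (c * ‖f z.1 - f z.2‖ ^ 2 / ‖z.1 - z.2‖ ^ (2 * σ)))
      ∂(volume.prod volume)

theorem measurable_expIncr_integrand (c σ : ℝ) :
    Measurable fun q : Omega L × (AddCircle L × AddCircle L) =>
      ENNReal.ofReal (Real.exp (c * ‖q.1 q.2.1 - q.1 q.2.2‖ ^ 2 / ‖q.2.1 - q.2.2‖ ^ (2 * σ))) := by
  have h1 : Continuous fun q : Omega L × (AddCircle L × AddCircle L) => q.1 q.2.1 := by fun_prop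
  have h2 : Continuous fun q : Omega L × (AddCircle L × AddCircle L) => q.1 q.2.2 := by fun_prop
  have h3 : Measurable fun q : Omega L × (AddCircle L × AddCircle L) => c * ‖q.1 q.2.1 - q.1 q.2.2‖ ^ 2 :=
    (continuous_const.mul ((h1.sub h2).norm.pow 2)).measurable
  have h4 : Measurable fun q : Omega L × (AddCircle L × AddCircle L) => ‖q.2.1 - q.2.2‖ := by
    have : Continuous fun q : Omega L × (AddCircle L × AddCircle L) => ‖q.2.1 - q.2.2‖ := by fun_prop
    exact this.measurable
  exact (Real.measurable_exp.comp (h3.div (h4.pow_const _))).ennreal_ofReal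

theorem measurable_expIncr (c σ : ℝ) : Measurable (expIncr (L := L) c σ) :=
  (measurable_expIncr_integrand c σ).lintegral_prod_right'

theorem measurable_expIncr_integrand_right (c σ : ℝ) (f : Omega L) :
    Measurable fun z : AddCircle L × AddCircle L =>
      ENNReal.ofReal (Real.exp (c * ‖f z.1 - f z.2‖ ^ 2 / ‖z.1 - z.2‖ ^ (2 * σ))) := by
  have h := (measurable_expIncr_integrand (L := L) c σ).comp (measurable_prodMk_left (x := f))
  exact h

/-- Fatou's lemma: the integrands converge pointwise, so sublevel sets of the functional are closed
under uniform limits. -/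
theorem expIncr_le_of_tendsto {c σ : ℝ} {f : ℕ → Omega L} {g : Omega L} {K : ℝ≥0∞}
    (hf : Tendsto f atTop (𝓝 g)) (hK : ∀ n, expIncr c σ (f n) ≤ K) : expIncr c σ g ≤ K := by
  have hlim : ∀ z : AddCircle L × AddCircle L, Tendsto (fun n =>
      ENNReal.ofReal (Real.exp (c * ‖f n z.1 - f n z.2‖ ^ 2 / ‖z.1 - z.2‖ ^ (2 * σ)))) atTop
      (𝓝 (ENNReal.ofReal (Real.exp (c * ‖g z.1 - g z.2‖ ^ 2 / ‖z.1 - z.2‖ ^ (2 * σ))))) := by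
    intro z
    have h : ∀ x, Tendsto (fun n => f n x) atTop (𝓝 (g x)) := fun x =>
      ((continuous_eval_const x).tendsto g).comp hf
    refine ENNReal.tendsto_ofReal ((Real.continuous_exp.tendsto _).comp ?_)
    exact ((((h z.1).sub (h z.2)).norm.pow 2).const_mul c).div_const _
  calc expIncr c σ g
      = ∫⁻ z : AddCircle L × AddCircle L, liminf (fun n =>
        ENNReal.ofReal (Real.exp (c * ‖f n z.1 - f n z.2‖ ^ 2 / ‖z.1 - z.2‖ ^ (2 * σ)))) atTop
        ∂(volume.prod volume) := lintegral_congr fun z => (hlim z).liminf_eq.symm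
    _ ≤ liminf (fun n => expIncr c σ (f n)) atTop :=
        lintegral_liminf_le fun n => measurable_expIncr_integrand_right c σ (f n)
    _ ≤ K := liminf_le_of_le (by isBoundedDefault) fun b hb =>
        let ⟨n, hn⟩ := hb.exists
        hn.trans (hK n)

/-- For `u > T ≥ 1` one has `u² - T² ≥ u - T`. This linearises the exponential: a normalised
increment is at most the threshold `T` plus an error weighted by `exp (-T²)`. -/
theorem le_add_exp_sq_sub_sq {u T : ℝ} (hu : 0 ≤ u) (hT : 1 ≤ T) :
    u ≤ T + Real.exp (u ^ 2 - T ^ 2) := by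
  rcases le_or_gt u T with h | h
  · exact h.trans (le_add_of_nonneg_right (Real.exp_pos _).le)
  · have := Real.add_one_le_exp (u ^ 2 - T ^ 2)
    nlinarith

theorem volume_real_closedBall (x : AddCircle L) {h : ℝ} (h0 : 0 < h) (h1 : h ≤ L / 2) :
    volume.real (Metric.closedBall x h) = 2 * h := by
  rw [Measure.real, AddCircle.volume_closedBall, min_eq_right (by linarith),
    ENNReal.toReal_ofReal (by linarith)]

/-- The mean of `f` over two sets, compared through the Garsia–Rodemich–Rumsey functional. -/
theorem norm_setAverage_sub_le {c σ : ℝ} (hc : 0 < c) (hσ : 0 < σ) (f : Omega L) {I J : Set (AddCircle L)}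
    (hI : MeasurableSet I) (hJ : MeasurableSet J) {a b d T K : ℝ} (ha : 0 < a) (hb : 0 < b)
    (hIa : volume.real I = a) (hJb : volume.real J = b)
    (hd : ∀ y ∈ I, ∀ z ∈ J, ‖y - z‖ ≤ d) (hT : 1 ≤ T) (hK : 0 ≤ K)
    (hB : expIncr c σ f ≤ ENNReal.ofReal K) (hd0 : 0 ≤ d) :
    ‖(⨍ y in I, f y) - ⨍ z in J, f z‖ ≤
      (Real.sqrt c)⁻¹ * d ^ σ * (T + Real.exp (-T ^ 2) * K / (a * b)) := by
  set ν := ((volume : Measure (AddCircle L)).restrict I).prod ((volume : Measure (AddCircle L)).restrict J)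
    with hν
  set G : AddCircle L × AddCircle L → ℝ := fun z =>
    Real.exp (c * ‖f z.1 - f z.2‖ ^ 2 / ‖z.1 - z.2‖ ^ (2 * σ)) with hG
  have hνr : ν = (volume.prod volume).restrict (I ×ˢ J) := Measure.prod_restrict I J
  have hGm : Measurable G := by
    have h := (measurable_expIncr_integrand_right c σ f).ennreal_toReal
    have : (fun z : AddCircle L × AddCircle L => (ENNReal.ofReal (Real.exp
        (c * ‖f z.1 - f z.2‖ ^ 2 / ‖z.1 - z.2‖ ^ (2 * σ)))).toReal) = G := by
      funext z
      exact ENNReal.toReal_ofReal (Real.exp_pos _).le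
    rwa [this] at h
  have hGl : ∫⁻ z, ENNReal.ofReal (G z) ∂ν ≤ ENNReal.ofReal K := by
    rw [hνr]
    exact (setLIntegral_le_lintegral _ _).trans hB
  have hGi : Integrable G ν := by
    refine ⟨hGm.aestronglyMeasurable, ?_⟩
    rw [hasFiniteIntegral_iff_ofReal (ae_of_all _ fun z => (Real.exp_pos _).le)]
    exact hGl.trans_lt ENNReal.ofReal_lt_top
  have hGK : ∫ z, G z ∂ν ≤ K := by
    rw [integral_eq_lintegral_of_nonneg_ae (ae_of_all _ fun z => (Real.exp_pos _).le)
      hGm.aestronglyMeasurable]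
    exact ENNReal.toReal_le_of_le_ofReal hK hGl
  have hνu : ν.real univ = a * b := by
    rw [measureReal_def, hν, ← univ_prod_univ, Measure.prod_prod]
    simp [ENNReal.toReal_mul, ← measureReal_def, hIa, hJb]
  have hfi : ∀ S : Set (AddCircle L), Integrable (fun x => f x) (volume.restrict S) := fun S =>
    ((f.continuous.integrable_of_hasCompactSupport
      (HasCompactSupport.of_compactSpace f)).restrict)
  -- The previous inequality is applied to `u = √c |f y - f z| / |y - z|^σ`, whose squared
  -- exponential is the integrand `G`. On the diagonal the left side vanishes.
  have hpt : ∀ᵐ z ∂ν, ‖f z.1 - f z.2‖ ≤ (Real.sqrt c)⁻¹ * d ^ σ * (T + Real.exp (-T ^ 2) * G z) := by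
    rw [hνr]
    refine (ae_restrict_iff' (hI.prod hJ)).2 (ae_of_all _ fun z hz => ?_)
    have hdz := hd z.1 hz.1 z.2 hz.2
    have hsc : 0 < Real.sqrt c := Real.sqrt_pos.2 hc
    rcases (norm_nonneg (z.1 - z.2)).eq_or_lt with h0 | h0
    · have : z.1 = z.2 := by rw [← sub_eq_zero, ← norm_eq_zero, ← h0]
      rw [this, sub_self, norm_zero]
      have := Real.exp_pos (-T ^ 2)
      have : 0 < G z := Real.exp_pos _
      positivity
    · set u := Real.sqrt c * ‖f z.1 - f z.2‖ / ‖z.1 - z.2‖ ^ σ with hu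
      have hp : 0 < ‖z.1 - z.2‖ ^ σ := Real.rpow_pos_of_pos h0 σ
      have hu0 : 0 ≤ u := by positivity
      have hu2 : u ^ 2 = c * ‖f z.1 - f z.2‖ ^ 2 / ‖z.1 - z.2‖ ^ (2 * σ) := by
        rw [hu, div_pow, mul_pow, Real.sq_sqrt hc.le, mul_comm 2 σ, Real.rpow_mul h0.le,
          Real.rpow_two]
      have h1 := le_add_exp_sq_sub_sq hu0 hT
      have h2 : Real.exp (u ^ 2 - T ^ 2) = Real.exp (-T ^ 2) * G z := by
        simp only [hG]
        rw [← hu2, ← Real.exp_add]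
        ring_nf
      rw [h2] at h1
      have h3 : ‖f z.1 - f z.2‖ = (Real.sqrt c)⁻¹ * ‖z.1 - z.2‖ ^ σ * u := by
        rw [hu]
        field_simp
      rw [h3]
      have h4 : ‖z.1 - z.2‖ ^ σ ≤ d ^ σ := Real.rpow_le_rpow h0.le hdz hσ.le
      gcongr
  have hbi : Integrable (fun z => (Real.sqrt c)⁻¹ * d ^ σ * (T + Real.exp (-T ^ 2) * G z)) ν :=
    ((integrable_const T).add (hGi.const_mul _)).const_mul _
  have hdiff : ∫ z, (f z.1 - f z.2) ∂ν = (b : ℂ) * (∫ y in I, f y) - (a : ℂ) * ∫ z in J, f z := by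
    rw [integral_sub ((hfi I).comp_fst _) ((hfi J).comp_snd _),
      integral_fun_fst (μ := volume.restrict I) (ν := volume.restrict J) (fun x => f x),
      integral_fun_snd (μ := volume.restrict I) (ν := volume.restrict J) (fun x => f x)]
    simp [hIa, hJb]
  have hav : (⨍ y in I, f y) - ⨍ z in J, f z = ((a * b : ℝ) : ℂ)⁻¹ * ∫ z, (f z.1 - f z.2) ∂ν := by
    rw [hdiff, setAverage_eq, setAverage_eq, hIa, hJb, Complex.real_smul, Complex.real_smul]
    have : (a : ℂ) ≠ 0 := by exact_mod_cast ha.ne'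
    have : (b : ℂ) ≠ 0 := by exact_mod_cast hb.ne'
    push_cast
    field_simp
  rw [hav, norm_mul, norm_inv, Complex.norm_real, Real.norm_of_nonneg (by positivity)]
  have hfin : ‖∫ z, (f z.1 - f z.2) ∂ν‖ ≤
      (Real.sqrt c)⁻¹ * d ^ σ * (T * (a * b) + Real.exp (-T ^ 2) * K) := by
    refine (norm_integral_le_of_norm_le hbi hpt).trans ?_
    rw [integral_const_mul, integral_add (integrable_const T) (hGi.const_mul _),
      integral_const_mul, integral_const, hνu, smul_eq_mul, mul_comm T]
    gcongr
  calc (a * b)⁻¹ * ‖∫ z, (f z.1 - f z.2) ∂ν‖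
      ≤ (a * b)⁻¹ * ((Real.sqrt c)⁻¹ * d ^ σ * (T * (a * b) + Real.exp (-T ^ 2) * K)) := by
        gcongr
    _ = _ := by field_simp

end Increments

/-! ### From the increment functional to oscillation bounds -/

section SupBound

set_option linter.unusedSectionVars false

variable {L : ℝ} [Fact (0 < L)]

/-- Means are compared at threshold `T = H z` with `z` of order `h^{-δ}`, `δ = σ - α`. The factor
`1/h²` from the volumes of the two balls costs a logarithm of `h`, and giving up the exponent `δ`
pays for it. -/
theorem norm_setAverage_closedBall_sub_le {c σ α : ℝ} (hc : 0 < c) (hα : 0 < α) (hασ : α < σ) :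
    ∃ C : ℝ, 0 < C ∧ ∀ (f : Omega L) (H : ℝ), 1 ≤ H →
      expIncr c σ f ≤ ENNReal.ofReal (Real.exp (H ^ 2)) → ∀ (x : AddCircle L) (h : ℝ), 0 < h →
        h ≤ L / 2 → ‖(⨍ y in Metric.closedBall x h, f y) -
          ⨍ y in Metric.closedBall x (h / 2), f y‖ ≤ C * H * h ^ α := by
  have hL : 0 < L := Fact.out
  set δ := σ - α with hδ
  have hδ0 : 0 < δ := sub_pos.2 hασ
  -- The term `δ⁻¹` lets `z²` dominate `log (1 / (2h²))`; the term `L^{2δ}` adds the 1 that makes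
  -- `z² ≥ 1`, hence `T ≥ 1`.
  set D := δ⁻¹ + L ^ (2 * δ) with hD
  have hD0 : 0 < D := by positivity
  refine ⟨(Real.sqrt c)⁻¹ * 2 ^ σ * (2 * Real.sqrt D), by positivity, ?_⟩
  intro f H hH hB x h h0 hhL
  set z := Real.sqrt D * h ^ (-δ) with hz
  have hz2 : z ^ 2 = D * h ^ (-(2 * δ)) := by
    rw [hz, mul_pow, Real.sq_sqrt hD0.le, ← Real.rpow_natCast (h ^ (-δ)), ← Real.rpow_mul h0.le]
    congr 2
    push_cast
    ring
  have hone : 1 ≤ L ^ (2 * δ) * h ^ (-(2 * δ)) := by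
    rw [Real.rpow_neg h0.le, ← div_eq_mul_inv, one_le_div (by positivity)]
    exact Real.rpow_le_rpow h0.le (by linarith) (by positivity)
  have hlog : Real.log ((2 * h ^ 2)⁻¹) ≤ z ^ 2 - 1 := by
    have h1 : Real.log h⁻¹ ≤ (h⁻¹) ^ (2 * δ) / (2 * δ) :=
      Real.log_le_rpow_div (inv_nonneg.2 h0.le) (by positivity)
    rw [Real.inv_rpow h0.le, ← Real.rpow_neg h0.le] at h1
    have h2 : Real.log ((2 * h ^ 2)⁻¹) = -Real.log 2 + 2 * Real.log h⁻¹ := by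
      rw [Real.log_inv, Real.log_mul (by norm_num) (by positivity), Real.log_pow, Real.log_inv]
      push_cast
      ring
    have h3 := Real.log_pos (one_lt_two)
    have h4 : 2 * (h ^ (-(2 * δ)) / (2 * δ)) = δ⁻¹ * h ^ (-(2 * δ)) := by
      field_simp
    rw [h2, hz2, hD, add_mul]
    linarith
  have hz1 : 1 ≤ z ^ 2 := by
    rw [hz2, hD, add_mul]
    have : 0 ≤ δ⁻¹ * h ^ (-(2 * δ)) := by positivity
    linarith
  have hz0 : 0 ≤ z := by positivity
  have hz1' : 1 ≤ z := by nlinarith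
  have hT : 1 ≤ H * z := by nlinarith
  have key := norm_setAverage_sub_le hc (hα.trans hασ) f (I := Metric.closedBall x h)
    (J := Metric.closedBall x (h / 2)) measurableSet_closedBall measurableSet_closedBall
    (a := 2 * h) (b := 2 * (h / 2)) (d := 2 * h) (T := H * z) (K := Real.exp (H ^ 2))
    (by positivity) (by positivity) (volume_real_closedBall x h0 hhL)
    (volume_real_closedBall x (by positivity) (by linarith))
    (fun y hy w hw => ?_) hT (Real.exp_pos _).le hB (by positivity)
  · refine key.trans ?_
    have hexp : Real.exp (-(H * z) ^ 2) * Real.exp (H ^ 2) / (2 * h * (2 * (h / 2))) ≤ 1 := by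
      rw [div_le_one (by positivity), ← Real.exp_add]
      have : -(H * z) ^ 2 + H ^ 2 ≤ Real.log (2 * h ^ 2) := by
        rw [Real.log_inv] at hlog
        nlinarith [mul_nonneg (sub_nonneg.2 hz1) (show (0:ℝ) ≤ H ^ 2 - 1 by nlinarith)]
      calc Real.exp (-(H * z) ^ 2 + H ^ 2) ≤ Real.exp (Real.log (2 * h ^ 2)) :=
            Real.exp_le_exp.2 this
        _ = 2 * h ^ 2 := Real.exp_log (by positivity)
        _ = _ := by ring
    calc (Real.sqrt c)⁻¹ * (2 * h) ^ σ * (H * z + Real.exp (-(H * z) ^ 2) * Real.exp (H ^ 2) /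
          (2 * h * (2 * (h / 2))))
        ≤ (Real.sqrt c)⁻¹ * (2 * h) ^ σ * (H * z + H * z) := by
          gcongr
          exact hexp.trans hT
      _ = (Real.sqrt c)⁻¹ * 2 ^ σ * (2 * Real.sqrt D) * H * (h ^ σ * h ^ (-δ)) := by
          rw [Real.mul_rpow (by norm_num) h0.le, hz]
          ring
      _ = _ := by
          rw [← Real.rpow_add h0]
          congr 2
          rw [hδ]
          ring
  · rw [← dist_eq_norm]
    have h1 := Metric.mem_closedBall.1 hy
    have h2 := Metric.mem_closedBall'.1 hw
    linarith [dist_triangle y x w]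

theorem tendsto_setAverage_closedBall (f : Omega L) (x : AddCircle L) {h : ℕ → ℝ}
    (h0 : ∀ n, 0 < h n) (h1 : ∀ n, h n ≤ L / 2) (hlim : Tendsto h atTop (𝓝 0)) :
    Tendsto (fun n => ⨍ y in Metric.closedBall x (h n), f y) atTop (𝓝 (f x)) := by
  rw [Metric.tendsto_atTop]
  intro ε hε
  obtain ⟨η, hη, hf⟩ := Metric.continuous_iff.1 f.continuous x (ε / 2) (by positivity)
  obtain ⟨N, hN⟩ := Metric.tendsto_atTop.1 hlim η hη
  refine ⟨N, fun n hn => ?_⟩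
  have hhn : h n < η := by
    have := hN n hn
    rw [Real.dist_eq, sub_zero, abs_of_pos (h0 n)] at this
    exact this
  have hv := volume_real_closedBall x (h0 n) (h1 n)
  have hfi : IntegrableOn (fun y => f y) (Metric.closedBall x (h n)) volume :=
    (f.continuous.integrable_of_hasCompactSupport (HasCompactSupport.of_compactSpace f)).integrableOn
  have hmem : (⨍ y in Metric.closedBall x (h n), f y) ∈ Metric.closedBall (f x) (ε / 2) := by
    refine (convex_closedBall _ _).set_average_mem Metric.isClosed_closedBall ?_ ?_ ?_ hfi
    · intro hzero
      rw [measureReal_def, hzero] at hv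
      have := h0 n
      simp at hv
      linarith
    · exact measure_ne_top _ _
    · refine (ae_restrict_iff' measurableSet_closedBall).2 (ae_of_all _ fun y hy => ?_)
      exact (hf y ((Metric.mem_closedBall.1 hy).trans_lt hhn)).le
  have := Metric.mem_closedBall.1 hmem
  linarith

/-- Means over balls of radius `h / 2^n` tend to `f x` by continuity, and their successive
differences form a geometric series of ratio `2^{-α}`. -/
theorem norm_sub_setAverage_closedBall_le {c σ α : ℝ} (hc : 0 < c) (hα : 0 < α) (hασ : α < σ) :
    ∃ C : ℝ, 0 < C ∧ ∀ (f : Omega L) (H : ℝ), 1 ≤ H →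
      expIncr c σ f ≤ ENNReal.ofReal (Real.exp (H ^ 2)) → ∀ (x : AddCircle L) (h : ℝ), 0 < h →
        h ≤ L / 2 → ‖f x - ⨍ y in Metric.closedBall x h, f y‖ ≤ C * H * h ^ α := by
  obtain ⟨C, hC, hstep⟩ := norm_setAverage_closedBall_sub_le (L := L) hc hα hασ
  set r : ℝ := (1 / 2 : ℝ) ^ α with hr
  have hr1 : r < 1 := Real.rpow_lt_one (by norm_num) (by norm_num) hα
  refine ⟨C / (1 - r), div_pos hC (sub_pos.2 hr1), ?_⟩
  intro f H hH hB x h h0 hhL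
  have hpos : ∀ n : ℕ, 0 < h / 2 ^ n := fun n => by positivity
  have hle : ∀ n : ℕ, h / 2 ^ n ≤ L / 2 := fun n =>
    (div_le_self h0.le (one_le_pow₀ one_le_two)).trans hhL
  have hlim : Tendsto (fun n : ℕ => h / 2 ^ n) atTop (𝓝 0) :=
    tendsto_const_nhds.div_atTop (tendsto_pow_atTop_atTop_of_one_lt one_lt_two)
  have hdist : ∀ n : ℕ, dist (⨍ y in Metric.closedBall x (h / 2 ^ n), f y)
      (⨍ y in Metric.closedBall x (h / 2 ^ (n + 1)), f y) ≤ C * H * h ^ α * r ^ n := by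
    intro n
    have h1 := hstep f H hH hB x (h / 2 ^ n) (hpos n) (hle n)
    rw [dist_eq_norm, pow_succ, ← div_div]
    refine h1.trans (le_of_eq ?_)
    have h2 : r ^ n = ((1 / 2 : ℝ) ^ n) ^ α := by
      rw [hr, ← Real.rpow_mul_natCast (by norm_num), mul_comm α, Real.rpow_natCast_mul (by norm_num)]
    rw [h2, mul_assoc (C * H), ← Real.mul_rpow h0.le (by positivity)]
    congr 2
    rw [one_div, inv_pow, div_eq_mul_inv]
  have := dist_le_of_le_geometric_of_tendsto₀ r (C * H * h ^ α) hr1 hdist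
    (tendsto_setAverage_closedBall f x hpos hle hlim)
  rw [pow_zero, div_one, dist_comm, dist_eq_norm] at this
  refine this.trans (le_of_eq ?_)
  ring

/-- The norm of `L²`, through the embedding of `Ω` into `L²`. -/
theorem norm_toLp_eq (f : Omega L) :
    ‖ContinuousMap.toLp (E := ℂ) 2 (volume : Measure (AddCircle L)) ℂ f‖ = norm_q 2 f := by
  rw [Lp.norm_def, norm_q, eLpNorm_congr_ae (ContinuousMap.coeFn_toLp volume f),
    toReal_eLpNorm f.continuous.aestronglyMeasurable]
  simp

theorem norm_q_two_sq (f : Omega L) : norm_q 2 f ^ 2 = ∫ x : AddCircle L, ‖f x‖ ^ 2 := by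
  rw [norm_q, lpNorm_eq_integral_norm_rpow_toReal (by simp) (by simp)
    f.continuous.aestronglyMeasurable, ← Real.rpow_natCast, ← Real.rpow_mul (by positivity)]
  simp

theorem norm_setAverage_closedBall_le (f : Omega L) (x : AddCircle L) {h : ℝ} (h0 : 0 < h)
    (hhL : h ≤ L / 2) :
    ‖⨍ y in Metric.closedBall x h, f y‖ ≤ (Real.sqrt (2 * h))⁻¹ * norm_q 2 f := by
  have hv := volume_real_closedBall x h0 hhL
  set n := norm_q 2 f with hn
  have hn0 : 0 ≤ n := lpNorm_nonneg
  set s := Real.sqrt (2 * h) with hs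
  have hs0 : 0 < s := Real.sqrt_pos.2 (by positivity)
  have hs2 : s ^ 2 = 2 * h := Real.sq_sqrt (by positivity)
  have hfi : Integrable (fun y => ‖f y‖ ^ 2) (volume : Measure (AddCircle L)) :=
    (f.continuous.norm.pow 2).integrable_of_hasCompactSupport
      (HasCompactSupport.of_compactSpace _)
  have hfi1 : Integrable (fun y => ‖f y‖) (volume : Measure (AddCircle L)) :=
    f.continuous.norm.integrable_of_hasCompactSupport (HasCompactSupport.of_compactSpace _)
  have hsq : (∫ y in Metric.closedBall x h, ‖f y‖) ^ 2 ≤ 2 * h * n ^ 2 := by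
    set J := ∫ y in Metric.closedBall x h, ‖f y‖ with hJ
    have hle : ∫ y in Metric.closedBall x h, ‖f y‖ ^ 2 ≤ n ^ 2 := by
      rw [hn, norm_q_two_sq]
      exact setIntegral_le_integral hfi (ae_of_all _ fun y => by positivity)
    -- Cauchy–Schwarz against the constant 1, as nonnegativity of the variance of `|f|` on the ball.
    have hnn : 0 ≤ ∫ y in Metric.closedBall x h, (‖f y‖ - J / (2 * h)) ^ 2 :=
      integral_nonneg fun y => sq_nonneg _
    have hexp : ∫ y in Metric.closedBall x h, (‖f y‖ - J / (2 * h)) ^ 2 =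
        (∫ y in Metric.closedBall x h, ‖f y‖ ^ 2) - 2 * (J / (2 * h)) * J +
          2 * h * (J / (2 * h)) ^ 2 := by
      have : ∀ y, (‖f y‖ - J / (2 * h)) ^ 2 =
          (‖f y‖ ^ 2 - 2 * (J / (2 * h)) * ‖f y‖) + (J / (2 * h)) ^ 2 := fun y => by ring
      simp_rw [this]
      have hi : Integrable (fun y => ‖f y‖ ^ 2 - 2 * (J / (2 * h)) * ‖f y‖)
          (volume.restrict (Metric.closedBall x h)) := hfi.restrict.sub (hfi1.restrict.const_mul _)
      rw [integral_add hi (integrable_const _),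
        integral_sub hfi.restrict (hfi1.restrict.const_mul _), integral_const_mul, integral_const,
        measureReal_restrict_apply_univ, hv, smul_eq_mul]
    rw [hexp] at hnn
    have h3 : 2 * (J / (2 * h)) * J - 2 * h * (J / (2 * h)) ^ 2 = J ^ 2 / (2 * h) := by
      field_simp
      ring
    have h4 : J ^ 2 / (2 * h) ≤ n ^ 2 := by linarith
    rw [div_le_iff₀ (by positivity)] at h4
    linarith
  have h1 : ‖∫ y in Metric.closedBall x h, f y‖ ≤ s * n := by
    refine (norm_integral_le_integral_norm _).trans ?_
    refine le_of_sq_le_sq ?_ (by positivity)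
    rw [mul_pow, hs2]
    exact hsq
  rw [setAverage_eq, hv, norm_smul, norm_inv, Real.norm_of_nonneg (by positivity), ← hs2]
  calc (s ^ 2)⁻¹ * ‖∫ y in Metric.closedBall x h, f y‖ ≤ (s ^ 2)⁻¹ * (s * n) := by gcongr
    _ = _ := by field_simp

/-- Used for compactness: `h` is chosen first to make the oscillation term small, and closeness in
`L²` then handles the mean of the difference. -/
theorem norm_apply_le_of_expIncr_le {c σ α : ℝ} (hc : 0 < c) (hα : 0 < α) (hασ : α < σ) :
    ∃ C : ℝ, 0 < C ∧ ∀ (f g : Omega L) (H : ℝ), 1 ≤ H →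
      expIncr c σ f ≤ ENNReal.ofReal (Real.exp (H ^ 2)) →
      expIncr c σ g ≤ ENNReal.ofReal (Real.exp (H ^ 2)) → ∀ (x : AddCircle L) (h : ℝ), 0 < h →
        h ≤ L / 2 → ‖(f - g) x‖ ≤ C * H * h ^ α + (Real.sqrt (2 * h))⁻¹ * norm_q 2 (f - g) := by
  obtain ⟨C, hC, hosc⟩ := norm_sub_setAverage_closedBall_le (L := L) hc hα hασ
  refine ⟨2 * C, by positivity, fun f g H hH hf hg x h h0 hhL => ?_⟩
  have h1 := hosc f H hH hf x h h0 hhL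
  have h2 := hosc g H hH hg x h h0 hhL
  have h3 := norm_setAverage_closedBall_le (f - g) x h0 hhL
  have hfi : ∀ f : Omega L, IntegrableOn (fun y => f y) (Metric.closedBall x h) volume := fun f =>
    (f.continuous.integrable_of_hasCompactSupport (HasCompactSupport.of_compactSpace f)).integrableOn
  have h4 : (⨍ y in Metric.closedBall x h, (f - g) y) =
      (⨍ y in Metric.closedBall x h, f y) - ⨍ y in Metric.closedBall x h, g y := by
    simp only [setAverage_eq, ContinuousMap.sub_apply]
    rw [integral_sub (hfi f) (hfi g), smul_sub]
  have h5 : (f - g) x = (f x - ⨍ y in Metric.closedBall x h, f y) -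
      (g x - ⨍ y in Metric.closedBall x h, g y) + ⨍ y in Metric.closedBall x h, (f - g) y := by
    rw [h4, ContinuousMap.sub_apply]
    ring
  rw [h5]
  refine (norm_add_le _ _).trans ?_
  have := norm_sub_le (f x - ⨍ y in Metric.closedBall x h, f y)
    (g x - ⨍ y in Metric.closedBall x h, g y)
  linarith

end SupBound

/-! ### Square-exponential moments of Gaussian sums -/

section Gaussian

theorem mgf_re_mul_gaussianPlane {θ : ℝ} (hθ : 0 < θ) (w : ℂ) (t : ℝ) :
    mgf (fun z : ℂ => (w * z).re) (gaussianPlane θ) t = Real.exp (‖w‖ ^ 2 / θ * t ^ 2 / 2) := by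
  have hm : Measurable Complex.measurableEquivRealProd.symm :=
    Complex.measurableEquivRealProd.symm.measurable
  have h1 : ∀ s : ℝ, ∫ x, Real.exp (s * x) ∂(gaussianReal 0 (θ⁻¹).toNNReal) =
      Real.exp (θ⁻¹ * s ^ 2 / 2) := by
    intro s
    have := congrFun (mgf_fun_id_gaussianReal (μ := 0) (v := (θ⁻¹).toNNReal)) s
    rw [mgf] at this
    rw [this, zero_mul, zero_add, Real.coe_toNNReal _ (inv_nonneg.2 hθ.le)]
  rw [mgf, gaussianPlane, integral_map hm.aemeasurable (by fun_prop)]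
  have h2 : ∀ q : ℝ × ℝ, Real.exp (t * (w * Complex.measurableEquivRealProd.symm q).re) =
      Real.exp (t * w.re * q.1) * Real.exp (-(t * w.im) * q.2) := by
    intro q
    rw [← Real.exp_add, Complex.mul_re, Complex.measurableEquivRealProd_symm_apply]
    congr 1
    simp only
    ring
  simp_rw [h2]
  rw [integral_prod_mul (fun x => Real.exp (t * w.re * x)) (fun y => Real.exp (-(t * w.im) * y)), h1, h1,
    ← Real.exp_add, ← Complex.normSq_eq_norm_sq, Complex.normSq_apply]
  congr 1
  field_simp

/-- Finite linear combinations of independent complex Gaussians have Gaussian real part. -/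
theorem mgf_re_sum_infinitePi {ι : Type*} {θ : ι → ℝ} (hθ : ∀ k, 0 < θ k) (s : Finset ι)
    (a : ι → ℂ) (t : ℝ) :
    mgf (fun X : ι → ℂ => (∑ k ∈ s, a k * X k).re) (Measure.infinitePi fun k => gaussianPlane (θ k)) t =
      Real.exp ((∑ k ∈ s, ‖a k‖ ^ 2 / θ k) * t ^ 2 / 2) := by
  have hm : ∀ k, Measurable fun z : ℂ => (a k * z).re := fun k => by fun_prop
  have hind := iIndepFun_infinitePi (P := fun k => gaussianPlane (θ k))
    (X := fun k (z : ℂ) => (a k * z).re) hm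
  have hsum := hind.mgf_sum (t := t) (fun k => (hm k).comp (measurable_pi_apply k)) s
  have heq : (∑ k ∈ s, fun X : ι → ℂ => (a k * X k).re) =
      fun X : ι → ℂ => (∑ k ∈ s, a k * X k).re := by
    funext X
    simp
  rw [← heq, hsum, Finset.sum_mul, Finset.sum_div, Real.exp_sum]
  refine Finset.prod_congr rfl fun k _ => ?_
  rw [← mgf_re_mul_gaussianPlane (hθ k)]
  have := mgf_map (μ := Measure.infinitePi fun k => gaussianPlane (θ k)) (Y := fun X : ι → ℂ => X k)
    (X := fun z : ℂ => (a k * z).re) (t := t) (measurable_pi_apply k).aemeasurable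
    (by fun_prop)
  rw [Measure.infinitePi_map_eval] at this
  exact this.symm

/-- A random variable with Gaussian moment generating function is square-exponentially integrable,
uniformly in the variance. -/
theorem exists_lintegral_exp_sq_le : ∃ c₀ : ℝ, 0 < c₀ ∧ ∃ M : ℝ≥0∞, M ≠ ∞ ∧
    ∀ {Ω : Type} [MeasurableSpace Ω] (P : Measure Ω) [IsProbabilityMeasure P] (Y : Ω → ℝ) (v c : ℝ),
      Measurable Y → (∀ t, mgf Y P t = Real.exp (v * t ^ 2 / 2)) → 0 ≤ c → c * v ≤ c₀ →
        ∫⁻ ω, ENNReal.ofReal (Real.exp (c * Y ω ^ 2)) ∂P ≤ M := by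
  obtain ⟨c₀, hc₀, hint⟩ := IsGaussian.exists_integrable_exp_sq (gaussianReal 0 1)
  refine ⟨c₀, hc₀, ∫⁻ g, ENNReal.ofReal (Real.exp (c₀ * ‖g‖ ^ 2)) ∂(gaussianReal 0 1),
    hint.lintegral_lt_top.ne, ?_⟩
  intro Ω _ P _ Y v c hY hmgf hc hcv
  have hg : ∀ s : ℝ, ∫⁻ g, ENNReal.ofReal (Real.exp (s * g)) ∂(gaussianReal 0 1) =
      ENNReal.ofReal (Real.exp (s ^ 2 / 2)) := by
    intro s
    rw [← ofReal_integral_eq_lintegral_ofReal (integrable_exp_mul_gaussianReal s)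
      (ae_of_all _ fun x => (Real.exp_pos _).le)]
    have := congrFun (mgf_fun_id_gaussianReal (μ := 0) (v := 1)) s
    rw [mgf] at this
    rw [this]
    simp
  have hYint : ∀ t : ℝ, ∫⁻ ω, ENNReal.ofReal (Real.exp (t * Y ω)) ∂P =
      ENNReal.ofReal (Real.exp (v * t ^ 2 / 2)) := by
    intro t
    have hi : Integrable (fun ω => Real.exp (t * Y ω)) P := by
      rw [← mgf_pos_iff, hmgf]
      exact Real.exp_pos _
    rw [← ofReal_integral_eq_lintegral_ofReal hi (ae_of_all _ fun x => (Real.exp_pos _).le),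
      ← hmgf, mgf]
  calc ∫⁻ ω, ENNReal.ofReal (Real.exp (c * Y ω ^ 2)) ∂P
      -- An auxiliary standard Gaussian `g` linearises the square: `exp (c Y²)` is the mean of `exp
      -- (√(2c) Y g)`. After Tonelli, the moment generating function of `Y` leaves `exp (c v g²)`,
      -- bounded through `c v ≤ c₀`.
      = ∫⁻ ω, ∫⁻ g, ENNReal.ofReal (Real.exp (Real.sqrt (2 * c) * Y ω * g)) ∂(gaussianReal 0 1) ∂P := by
        refine lintegral_congr fun ω => ?_
        rw [hg, mul_pow, Real.sq_sqrt (by positivity)]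
        congr 2
        ring
    _ = ∫⁻ g, ∫⁻ ω, ENNReal.ofReal (Real.exp (Real.sqrt (2 * c) * Y ω * g)) ∂P ∂(gaussianReal 0 1) := by
        refine lintegral_lintegral_swap ?_
        have : Measurable fun q : Ω × ℝ =>
            ENNReal.ofReal (Real.exp (Real.sqrt (2 * c) * Y q.1 * q.2)) := by fun_prop
        exact this.aemeasurable
    _ ≤ ∫⁻ g, ENNReal.ofReal (Real.exp (c₀ * ‖g‖ ^ 2)) ∂(gaussianReal 0 1) := by
        refine lintegral_mono fun g => ?_
        have h1 : ∀ ω, Real.sqrt (2 * c) * Y ω * g = Real.sqrt (2 * c) * g * Y ω := fun ω => by ring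
        simp_rw [h1]
        rw [hYint]
        refine ENNReal.ofReal_le_ofReal (Real.exp_le_exp.2 ?_)
        rw [mul_pow, Real.sq_sqrt (by positivity), Real.norm_eq_abs, sq_abs]
        nlinarith [mul_le_mul_of_nonneg_right hcv (sq_nonneg g)]

theorem exp_add_le (a b : ℝ) : Real.exp (a + b) ≤ Real.exp (2 * a) + Real.exp (2 * b) := by
  rw [Real.exp_add, two_mul, two_mul, Real.exp_add, Real.exp_add]
  nlinarith [sq_nonneg (Real.exp a - Real.exp b), Real.exp_pos a, Real.exp_pos b]

/-- Square-exponential integrability of finite linear combinations of independent complex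
Gaussians, uniformly in the variance. -/
theorem exists_lintegral_exp_norm_sum_sq_le : ∃ c₀ : ℝ, 0 < c₀ ∧ ∃ M : ℝ≥0∞, M ≠ ∞ ∧
    ∀ (θ : ℤ → ℝ), (∀ k, 0 < θ k) → ∀ (s : Finset ℤ) (a : ℤ → ℂ) (c : ℝ), 0 ≤ c →
      c * (∑ k ∈ s, ‖a k‖ ^ 2 / θ k) ≤ c₀ →
        ∫⁻ X, ENNReal.ofReal (Real.exp (c * ‖∑ k ∈ s, a k * X k‖ ^ 2))
          ∂(Measure.infinitePi fun k => gaussianPlane (θ k)) ≤ M := by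
  obtain ⟨c₀, hc₀, M, hM, hmain⟩ := exists_lintegral_exp_sq_le
  refine ⟨c₀ / 2, by positivity, M + M, ENNReal.add_ne_top.2 ⟨hM, hM⟩, ?_⟩
  intro θ hθ s a c hc hcv
  set P := Measure.infinitePi fun k => gaussianPlane (θ k)
  have hZ : ∀ b : ℤ → ℂ, Measurable fun X : ℤ → ℂ => (∑ k ∈ s, b k * X k).re := fun b => by fun_prop
  have h1 := hmain P (fun X => (∑ k ∈ s, a k * X k).re) _ (2 * c) (hZ a)
    (mgf_re_sum_infinitePi hθ s a) (by positivity) (by linarith)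
  -- The imaginary part is the real part after multiplication by `-i`. The two parts are then
  -- separated by `exp_add_le`, at the price of doubling `c`; their independence is not needed.
  have h2 := hmain P (fun X => (∑ k ∈ s, (-Complex.I * a k) * X k).re) _ (2 * c)
    (hZ fun k => -Complex.I * a k)
    (mgf_re_sum_infinitePi hθ s fun k => -Complex.I * a k) (by positivity) (by
      simp only [norm_mul, norm_neg, Complex.norm_I, one_mul]
      linarith)
  refine le_trans ?_ (add_le_add h1 h2)
  rw [← lintegral_add_left (by fun_prop)]
  refine lintegral_mono fun X => ?_
  rw [← ENNReal.ofReal_add (Real.exp_pos _).le (Real.exp_pos _).le]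
  refine ENNReal.ofReal_le_ofReal ?_
  have h3 : (∑ k ∈ s, (-Complex.I * a k) * X k).re = (∑ k ∈ s, a k * X k).im := by
    simp_rw [mul_assoc, ← Finset.mul_sum]
    simp
  rw [h3]
  refine le_trans (le_of_eq ?_) ((exp_add_le (c * (∑ k ∈ s, a k * X k).re ^ 2)
    (c * (∑ k ∈ s, a k * X k).im ^ 2)).trans (le_of_eq ?_))
  · rw [← Complex.normSq_eq_norm_sq, Complex.normSq_apply]
    ring_nf
  · ring_nf

end Gaussian

/-! ### Eigenvalue sums and increments of plane waves -/

section Spectrum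

theorem eigenvalue_pos (L : ℝ) {m : ℝ} (hm : 0 < m) (k : ℤ) : 0 < eigenvalue L m k := by
  rw [eigenvalue]
  positivity

theorem summable_eigenvalue_rpow {L m s : ℝ} (hL : 0 < L) (hm : 0 < m) (hs : s < -(1 / 2)) :
    Summable fun k : ℤ => eigenvalue L m k ^ s := by
  have h1 : Summable fun k : ℤ => ((2 * Real.pi / L) ^ 2) ^ s * |(k : ℝ)| ^ (-(-(2 * s))) :=
    (Real.summable_abs_int_rpow (by linarith)).mul_left _
  -- The mode `k = 0` is treated apart: the comparison with `|k|^{2s}` fails there.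
  have h2 : Summable fun k : ℤ => if k = 0 then eigenvalue L m 0 ^ s else 0 :=
    summable_of_ne_finset_zero (s := {0}) fun k hk => by
      rw [if_neg]
      simpa using hk
  refine Summable.of_nonneg_of_le (fun k => (Real.rpow_pos_of_pos (eigenvalue_pos L hm k) s).le)
    (fun k => ?_) (h1.add h2)
  have hp : 0 ≤ ((2 * Real.pi / L) ^ 2) ^ s * |(k : ℝ)| ^ (-(-(2 * s))) := by positivity
  by_cases hk : k = 0
  · subst hk
    simp only [if_true]
    linarith
  · simp only [if_neg hk, add_zero]
    have hk' : 0 < |(k : ℝ)| := abs_pos.2 (by exact_mod_cast hk)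
    have h3 : ((2 * Real.pi / L) ^ 2) ^ s * |(k : ℝ)| ^ (-(-(2 * s))) =
        ((2 * Real.pi / L) ^ 2 * |(k : ℝ)| ^ 2) ^ s := by
      rw [Real.mul_rpow (by positivity) (by positivity), neg_neg, Real.rpow_mul hk'.le,
        Real.rpow_two]
    rw [h3]
    refine Real.rpow_le_rpow_of_nonpos (by positivity) ?_ (by linarith)
    rw [eigenvalue, sq_abs]
    have : (2 * Real.pi * k / L) ^ 2 = (2 * Real.pi / L) ^ 2 * (k : ℝ) ^ 2 := by ring
    rw [this]
    nlinarith [sq_nonneg m]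

/-- With `t` the phase of the shortest representative of `x`, `|e^{it} - 1|` is at most both 2 and
`|t|`. Its square is therefore at most `4 |t|^{2σ}`, and `t² ≤ λ_k ‖x‖²`. -/
theorem norm_fourier_sub_one_sq_le {L m σ : ℝ} (hσ0 : 0 < σ) (hσ1 : σ < 1)
    (k : ℤ) (x : AddCircle L) :
    ‖fourier k x - 1‖ ^ 2 ≤ 4 * (eigenvalue L m k ^ σ * ‖x‖ ^ (2 * σ)) := by
  obtain ⟨r, rfl, hr⟩ : ∃ r : ℝ, (r : AddCircle L) = x ∧ |r| = ‖x‖ := by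
    obtain ⟨y, rfl⟩ := QuotientAddGroup.mk_surjective x
    refine ⟨y - round (L⁻¹ * y) * L, ?_, (AddCircle.norm_eq _).symm⟩
    have : ((round (L⁻¹ * y) * L : ℝ) : AddCircle L) = 0 := by
      rw [AddCircle.coe_eq_zero_iff]
      exact ⟨round (L⁻¹ * y), by simp⟩
    rw [AddCircle.coe_sub, this, sub_zero]
  set t : ℝ := 2 * Real.pi * k / L * r with ht
  have h1 : (fourier k (r : AddCircle L) : ℂ) = Complex.exp (Complex.I * (t : ℝ)) := by
    rw [fourier_coe_apply, ht]
    congr 1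
    push_cast
    ring
  have h2 : ‖fourier k (r : AddCircle L) - (1 : ℂ)‖ ≤ |t| := by
    rw [h1]
    exact Real.norm_exp_I_mul_ofReal_sub_one_le
  have h3 : ‖fourier k (r : AddCircle L) - (1 : ℂ)‖ ≤ 2 := by
    refine (norm_sub_le _ _).trans ?_
    rw [h1, Complex.norm_exp_I_mul_ofReal, norm_one]
    norm_num
  have h4 : (t ^ 2) ^ σ ≤ eigenvalue L m k ^ σ * ‖(r : AddCircle L)‖ ^ (2 * σ) := by
    rw [Real.rpow_mul (norm_nonneg _), Real.rpow_two, ← Real.mul_rpow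
      (by rw [eigenvalue]; positivity) (by positivity), ← hr, sq_abs]
    refine Real.rpow_le_rpow (by positivity) ?_ hσ0.le
    rw [ht, mul_pow, eigenvalue]
    nlinarith [sq_nonneg m, sq_nonneg r]
  have h5 : ‖fourier k (r : AddCircle L) - (1 : ℂ)‖ ^ 2 ≤ 4 * (t ^ 2) ^ σ := by
    rcases le_total 1 (t ^ 2) with h | h
    · have : 1 ≤ (t ^ 2) ^ σ := Real.one_le_rpow h hσ0.le
      nlinarith [norm_nonneg (fourier k (r : AddCircle L) - (1 : ℂ))]
    · have h6 : t ^ 2 ≤ (t ^ 2) ^ σ := Real.self_le_rpow_of_le_one (sq_nonneg t) h hσ1.le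
      have h7 : ‖fourier k (r : AddCircle L) - (1 : ℂ)‖ ^ 2 ≤ t ^ 2 := by
        rw [← sq_abs t]
        exact pow_le_pow_left₀ (norm_nonneg _) h2 2
      nlinarith [sq_nonneg t]
  linarith

theorem norm_planeWave_sub_sq_le {L m σ : ℝ} (hL : 0 < L) (hσ0 : 0 < σ) (hσ1 : σ < 1)
    (k : ℤ) (x y : AddCircle L) :
    ‖planeWave L k x - planeWave L k y‖ ^ 2 ≤
      4 / L * (eigenvalue L m k ^ σ * ‖x - y‖ ^ (2 * σ)) := by
  have h1 : planeWave L k x - planeWave L k y =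
      (Real.sqrt L : ℂ)⁻¹ * (fourier k y * (fourier k (x - y) - 1)) := by
    have h2 : (fourier k x : ℂ) = fourier k y * fourier k (x - y) := by
      conv_lhs => rw [← add_sub_cancel y x]
      simp only [fourier_apply, smul_add, AddCircle.toCircle_add, Circle.coe_mul]
    simp only [planeWave, ContinuousMap.smul_apply, smul_eq_mul]
    rw [h2]
    ring
  have h3 : ‖(fourier k y : ℂ)‖ = 1 := by rw [fourier_apply, Circle.norm_coe]
  rw [h1, norm_mul, norm_mul, h3, one_mul, mul_pow, norm_inv, Complex.norm_real,
    Real.norm_of_nonneg (Real.sqrt_nonneg L), inv_pow, Real.sq_sqrt hL.le]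
  calc L⁻¹ * ‖fourier k (x - y) - (1 : ℂ)‖ ^ 2
      ≤ L⁻¹ * (4 * (eigenvalue L m k ^ σ * ‖x - y‖ ^ (2 * σ))) := by
        gcongr
        exact norm_fourier_sub_one_sq_le hσ0 hσ1 k (x - y)
    _ = _ := by ring

end Spectrum

/-! ### Finite means of the two control functionals -/

section Functionals

set_option linter.unusedSectionVars false

variable {L : ℝ} [Fact (0 < L)]

/-- The symmetric partial sums of the series `∑ X_k u_k`. -/
def partialSum (L : ℝ) (N : ℕ) (X : ℤ → ℂ) : Omega L :=
  ∑ k ∈ Finset.Icc (-(N : ℤ)) N, X k • planeWave L k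

theorem continuous_partialSum (N : ℕ) : Continuous (partialSum L N) := by
  unfold partialSum
  fun_prop

theorem partialSum_sub_apply (N : ℕ) (X : ℤ → ℂ) (x y : AddCircle L) :
    partialSum L N X x - partialSum L N X y =
      ∑ k ∈ Finset.Icc (-(N : ℤ)) N, (planeWave L k x - planeWave L k y) * X k := by
  simp only [partialSum, ContinuousMap.sum_apply, ContinuousMap.smul_apply, smul_eq_mul]
  rw [← Finset.sum_sub_distrib]
  exact Finset.sum_congr rfl fun k _ => by ring

/-- By Tonelli it suffices to bound the mean at each pair of points, where the increment is a finite
Gaussian sum of variance at most a constant times `|x - y|^{2σ}`. The constant does not depend on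
`N` because `σ - 1 < -1/2`. -/
theorem exists_lintegral_expIncr_partialSum_le {m β σ : ℝ} (hm : 0 < m) (hβ : 0 < β) (hσ0 : 0 < σ)
    (hσ : σ < 1 / 2) : ∃ c : ℝ, 0 < c ∧ ∃ M : ℝ≥0∞, M ≠ ∞ ∧ ∀ N : ℕ,
      ∫⁻ X, expIncr c σ (partialSum L N X) ∂(modeLaw L m β) ≤ M := by
  have hL : 0 < L := Fact.out
  obtain ⟨c₀, hc₀, M, hM, hmain⟩ := exists_lintegral_exp_norm_sum_sq_le
  have hsum := summable_eigenvalue_rpow hL hm (s := σ - 1) (by linarith)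
  have hnn : ∀ k : ℤ, 0 ≤ eigenvalue L m k ^ (σ - 1) := fun k =>
    (Real.rpow_pos_of_pos (eigenvalue_pos L hm k) _).le
  set S := ∑' k : ℤ, eigenvalue L m k ^ (σ - 1) with hS
  have hS0 : 0 ≤ S := tsum_nonneg hnn
  set V := 4 / (L * β) * (S + 1) with hV
  have hV0 : 0 < V := by positivity
  have hvar : ∀ (N : ℕ) (x y : AddCircle L), ∑ k ∈ Finset.Icc (-(N : ℤ)) N,
      ‖planeWave L k x - planeWave L k y‖ ^ 2 / (β * eigenvalue L m k) ≤ V * ‖x - y‖ ^ (2 * σ) := by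
    intro N x y
    calc ∑ k ∈ Finset.Icc (-(N : ℤ)) N,
          ‖planeWave L k x - planeWave L k y‖ ^ 2 / (β * eigenvalue L m k)
        ≤ ∑ k ∈ Finset.Icc (-(N : ℤ)) N,
          (4 / (L * β) * ‖x - y‖ ^ (2 * σ)) * eigenvalue L m k ^ (σ - 1) := by
          refine Finset.sum_le_sum fun k _ => ?_
          have he := eigenvalue_pos L hm k
          rw [div_le_iff₀ (by positivity), Real.rpow_sub_one he.ne']
          refine (norm_planeWave_sub_sq_le (m := m) hL hσ0 (by linarith) k x y).trans (le_of_eq ?_)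
          field_simp
      _ ≤ (4 / (L * β) * ‖x - y‖ ^ (2 * σ)) * S := by
          rw [← Finset.mul_sum]
          gcongr
          exact hsum.sum_le_tsum _ fun k _ => hnn k
      _ ≤ V * ‖x - y‖ ^ (2 * σ) := by
          rw [hV]
          have : 0 ≤ 4 / (L * β) * ‖x - y‖ ^ (2 * σ) := by positivity
          nlinarith
  refine ⟨c₀ / V, by positivity, M * (volume.prod volume) (univ : Set (AddCircle L × AddCircle L)),
    ENNReal.mul_ne_top hM (measure_ne_top _ _), fun N => ?_⟩
  have hprob : IsProbabilityMeasure (modeLaw L m β) := by unfold modeLaw; infer_instance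
  calc ∫⁻ X, expIncr (c₀ / V) σ (partialSum L N X) ∂(modeLaw L m β)
      = ∫⁻ z : AddCircle L × AddCircle L, ∫⁻ X, ENNReal.ofReal (Real.exp (c₀ / V *
          ‖partialSum L N X z.1 - partialSum L N X z.2‖ ^ 2 / ‖z.1 - z.2‖ ^ (2 * σ)))
            ∂(modeLaw L m β) ∂(volume.prod volume) := by
        refine lintegral_lintegral_swap ?_
        have h1 : Measurable fun q : (ℤ → ℂ) × (AddCircle L × AddCircle L) => (partialSum L N q.1, q.2) :=
          ((continuous_partialSum N).measurable.comp measurable_fst).prodMk measurable_snd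
        have h2 := (measurable_expIncr_integrand (L := L) (c₀ / V) σ).comp h1
        exact h2.aemeasurable
    _ ≤ ∫⁻ _ : AddCircle L × AddCircle L, M ∂(volume.prod volume) := by
        refine lintegral_mono fun z => ?_
        have h1 := hmain (fun k => β * eigenvalue L m k)
          (fun k => mul_pos hβ (eigenvalue_pos L hm k)) (Finset.Icc (-(N : ℤ)) N)
          (fun k => planeWave L k z.1 - planeWave L k z.2) (c₀ / V / ‖z.1 - z.2‖ ^ (2 * σ))
          (by positivity) ?_
        · refine le_trans (le_of_eq ?_) h1
          unfold modeLaw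
          refine lintegral_congr fun X => ?_
          rw [partialSum_sub_apply]
          congr 2
          ring
        · calc c₀ / V / ‖z.1 - z.2‖ ^ (2 * σ) * _
              ≤ c₀ / V / ‖z.1 - z.2‖ ^ (2 * σ) * (V * ‖z.1 - z.2‖ ^ (2 * σ)) := by
                gcongr
                exact hvar N z.1 z.2
            _ ≤ c₀ := by
                -- On the diagonal, division by zero makes the coefficient 0.
                rcases eq_or_ne (‖z.1 - z.2‖ ^ (2 * σ)) 0 with h0 | h0
                · rw [h0, div_zero, zero_mul]
                  exact hc₀.le
                · exact le_of_eq (by field_simp)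
    _ = M * (volume.prod volume) univ := lintegral_const M

/-- An exponential functional of the modes that controls `∑ λ_k^s |X_k|²`. -/
def expModes (L m c s : ℝ) (X : ℤ → ℂ) : ℝ≥0∞ :=
  ∑' k : ℤ, ENNReal.ofReal (eigenvalue L m k ^ (s - 1) * Real.exp (c * eigenvalue L m k * ‖X k‖ ^ 2))

theorem measurable_expModes (m c s : ℝ) : Measurable (expModes L m c s) := by
  unfold expModes
  fun_prop

/-- The variance of `X_k` is of order `1/λ_k`, so each exponential has mean at most the same `M`;
the weights `λ_k^{s-1}` are summable since `s < 1/2`. -/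
theorem exists_lintegral_expModes_lt_top {m β s : ℝ} (hm : 0 < m) (hβ : 0 < β) (hs : s < 1 / 2) :
    ∃ c : ℝ, 0 < c ∧ ∫⁻ X, expModes L m c s X ∂(modeLaw L m β) < ∞ := by
  have hL : 0 < L := Fact.out
  obtain ⟨c₀, hc₀, M, hM, hmain⟩ := exists_lintegral_exp_norm_sum_sq_le
  have hsum := summable_eigenvalue_rpow hL hm (s := s - 1) (by linarith)
  have hnn : ∀ k : ℤ, 0 ≤ eigenvalue L m k ^ (s - 1) := fun k =>
    (Real.rpow_pos_of_pos (eigenvalue_pos L hm k) _).le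
  refine ⟨c₀ * β, by positivity, ?_⟩
  have hk : ∀ k : ℤ, ∫⁻ X, ENNReal.ofReal (eigenvalue L m k ^ (s - 1) *
      Real.exp (c₀ * β * eigenvalue L m k * ‖X k‖ ^ 2)) ∂(modeLaw L m β) ≤
        ENNReal.ofReal (eigenvalue L m k ^ (s - 1)) * M := by
    intro k
    have he := eigenvalue_pos L hm k
    simp_rw [ENNReal.ofReal_mul (hnn k)]
    rw [lintegral_const_mul _ (by fun_prop)]
    gcongr
    have h1 := hmain (fun k => β * eigenvalue L m k)
      (fun k => mul_pos hβ (eigenvalue_pos L hm k)) {k} (fun _ => 1) (c₀ * β * eigenvalue L m k)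
      (by positivity) (by
        simp only [Finset.sum_singleton, norm_one, one_pow]
        exact le_of_eq (by field_simp))
    simpa [modeLaw] using h1
  calc ∫⁻ X, expModes L m (c₀ * β) s X ∂(modeLaw L m β)
      = ∑' k : ℤ, ∫⁻ X, ENNReal.ofReal (eigenvalue L m k ^ (s - 1) *
          Real.exp (c₀ * β * eigenvalue L m k * ‖X k‖ ^ 2)) ∂(modeLaw L m β) :=
        lintegral_tsum fun k => Measurable.aemeasurable (by fun_prop)
    _ ≤ ∑' k : ℤ, ENNReal.ofReal (eigenvalue L m k ^ (s - 1)) * M := ENNReal.tsum_le_tsum hk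
    _ < ∞ := by
        rw [ENNReal.tsum_mul_right]
        refine ENNReal.mul_lt_top ?_ hM.lt_top
        rw [← ENNReal.ofReal_tsum_of_nonneg hnn hsum]
        exact ENNReal.ofReal_lt_top

/-- For `t = c λ_k |X_k|²` one has `t ≤ H² + exp (t - H²)`. Summed with weights `λ_k^{s-1}`, the
first term gives `H²` times a constant and the second at most 1. -/
theorem summable_and_tsum_le_of_expModes_le {m c s : ℝ} (hm : 0 < m) (hc : 0 < c) (hs : s < 1 / 2) :
    ∃ C : ℝ, 0 < C ∧ ∀ (X : ℤ → ℂ) (H : ℝ), 1 ≤ H →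
      expModes L m c s X ≤ ENNReal.ofReal (Real.exp (H ^ 2)) →
        (Summable fun k : ℤ => eigenvalue L m k ^ s * ‖X k‖ ^ 2) ∧
          ∑' k : ℤ, eigenvalue L m k ^ s * ‖X k‖ ^ 2 ≤ C * H ^ 2 := by
  have hL : 0 < L := Fact.out
  have hsum := summable_eigenvalue_rpow hL hm (s := s - 1) (by linarith)
  have hnn : ∀ k : ℤ, 0 ≤ eigenvalue L m k ^ (s - 1) := fun k =>
    (Real.rpow_pos_of_pos (eigenvalue_pos L hm k) _).le
  set S := ∑' k : ℤ, eigenvalue L m k ^ (s - 1) with hS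
  have hS0 : 0 ≤ S := tsum_nonneg hnn
  refine ⟨c⁻¹ * (S + 1), by positivity, fun X H hH hB => ?_⟩
  set e : ℤ → ℝ := fun k => eigenvalue L m k ^ (s - 1) * Real.exp (c * eigenvalue L m k * ‖X k‖ ^ 2)
    with he
  have he0 : ∀ k, 0 ≤ e k := fun k => mul_nonneg (hnn k) (Real.exp_pos _).le
  have hes : Summable e := by
    have h1 : ∑' k, ENNReal.ofReal (e k) ≠ ∞ := (hB.trans_lt ENNReal.ofReal_lt_top).ne
    have h2 := ENNReal.summable_toReal h1
    simpa only [ENNReal.toReal_ofReal (he0 _)] using h2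
  have het : ∑' k, e k ≤ Real.exp (H ^ 2) := by
    rw [expModes, ← ENNReal.ofReal_tsum_of_nonneg he0 hes] at hB
    exact (ENNReal.ofReal_le_ofReal_iff (Real.exp_pos _).le).1 hB
  have hbs : Summable fun k : ℤ =>
      c⁻¹ * (H ^ 2 * eigenvalue L m k ^ (s - 1) + Real.exp (-H ^ 2) * e k) :=
    ((hsum.mul_left _).add (hes.mul_left _)).mul_left _
  have hle : ∀ k : ℤ, eigenvalue L m k ^ s * ‖X k‖ ^ 2 ≤
      c⁻¹ * (H ^ 2 * eigenvalue L m k ^ (s - 1) + Real.exp (-H ^ 2) * e k) := by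
    intro k
    have hp := eigenvalue_pos L hm k
    set t := c * eigenvalue L m k * ‖X k‖ ^ 2 with ht
    have h1 : eigenvalue L m k ^ s * ‖X k‖ ^ 2 = c⁻¹ * (eigenvalue L m k ^ (s - 1) * t) := by
      rw [ht, Real.rpow_sub_one hp.ne']
      field_simp
    have h2 : t ≤ H ^ 2 + Real.exp (-H ^ 2) * Real.exp t := by
      rw [← Real.exp_add]
      have := Real.add_one_le_exp (-H ^ 2 + t)
      linarith
    rw [h1]
    refine mul_le_mul_of_nonneg_left ?_ (by positivity)
    refine (mul_le_mul_of_nonneg_left h2 (hnn k)).trans (le_of_eq ?_)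
    simp only [he]
    ring
  have hs' := Summable.of_nonneg_of_le (fun k => mul_nonneg
    (Real.rpow_pos_of_pos (eigenvalue_pos L hm k) s).le (sq_nonneg _)) hle hbs
  refine ⟨hs', (hs'.tsum_le_tsum hle hbs).trans ?_⟩
  rw [tsum_mul_left, (hsum.mul_left _).tsum_add (hes.mul_left _), tsum_mul_left, tsum_mul_left]
  have h3 : Real.exp (-H ^ 2) * ∑' k, e k ≤ 1 := by
    calc Real.exp (-H ^ 2) * ∑' k, e k ≤ Real.exp (-H ^ 2) * Real.exp (H ^ 2) := by gcongr
      _ = 1 := by rw [← Real.exp_add]; simp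
  rw [mul_assoc]
  refine mul_le_mul_of_nonneg_left ?_ (by positivity)
  nlinarith

end Functionals

/-! ### Continuous representatives and the total mass of the measure -/

section Reconstruction

set_option linter.unusedSectionVars false

variable {L : ℝ} [Fact (0 < L)]

/-- The plane waves as elements of `L²`. -/
def planeWaveLp (L : ℝ) [Fact (0 < L)] (k : ℤ) : Lp ℂ 2 (volume : Measure (AddCircle L)) :=
  ContinuousMap.toLp (E := ℂ) 2 volume ℂ (planeWave L k)

theorem mode_eq_inner (φ : Omega L) (k : ℤ) :
    mode L φ k = inner ℂ (planeWaveLp L k) (ContinuousMap.toLp (E := ℂ) 2 volume ℂ φ) := by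
  rw [planeWaveLp, ContinuousMap.inner_toLp]
  simp [mode, mul_comm]

theorem orthonormal_planeWaveLp : Orthonormal ℂ (planeWaveLp L) := by
  have hL : 0 < L := Fact.out
  have hs : (Real.sqrt L : ℂ) ≠ 0 := by exact_mod_cast (Real.sqrt_pos.2 hL).ne'
  rw [orthonormal_iff_ite]
  intro j k
  have h1 := orthonormal_iff_ite.1 (orthonormal_fourier (T := L)) j k
  rw [fourierLp, fourierLp, ContinuousMap.inner_toLp] at h1
  rw [← h1]
  have h2 : inner ℂ (planeWaveLp L j) (planeWaveLp L k) = mode L (planeWave L k) j :=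
    (mode_eq_inner _ _).symm
  rw [h2, mode_eq_fourierCoeff, fourierCoeff, ← integral_const_mul]
  congr 1
  funext x
  simp only [planeWave, ContinuousMap.smul_apply, smul_eq_mul, fourier_neg]
  field_simp

theorem toLp_partialSum (N : ℕ) (X : ℤ → ℂ) :
    ContinuousMap.toLp (E := ℂ) 2 volume ℂ (partialSum L N X) =
      ∑ k ∈ Finset.Icc (-(N : ℤ)) N, X k • planeWaveLp L k := by
  simp only [partialSum, map_sum, map_smul, planeWaveLp]

theorem mode_partialSum {N : ℕ} {k : ℤ} (X : ℤ → ℂ) (hk : k ∈ Finset.Icc (-(N : ℤ)) N) :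
    mode L (partialSum L N X) k = X k := by
  rw [mode_eq_inner, toLp_partialSum, orthonormal_planeWaveLp.inner_right_sum X hk]

theorem tendsto_Icc_neg_natCast_atTop :
    Tendsto (fun N : ℕ => Finset.Icc (-(N : ℤ)) N) atTop atTop := by
  refine tendsto_atTop_finset_of_monotone (fun a b hab => ?_) fun k => ⟨k.natAbs, ?_⟩
  · have : (a : ℤ) ≤ b := by exact_mod_cast hab
    exact Finset.Icc_subset_Icc (by linarith) this
  · rw [Finset.mem_Icc]
    omega

theorem summable_smul_planeWaveLp {X : ℤ → ℂ} (hX : Summable fun k => ‖X k‖ ^ 2) :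
    Summable fun k => X k • planeWaveLp L k := by
  have h := (orthonormal_planeWaveLp (L := L)).orthogonalFamily.summable_iff_norm_sq_summable X
  simpa using h.2 hX

theorem norm_tsum_smul_planeWaveLp_sq_le {X : ℤ → ℂ} (hX : Summable fun k => ‖X k‖ ^ 2) :
    ‖∑' k, X k • planeWaveLp L k‖ ^ 2 ≤ ∑' k, ‖X k‖ ^ 2 := by
  have h1 : Tendsto (fun s : Finset ℤ => ‖∑ k ∈ s, X k • planeWaveLp L k‖ ^ 2) atTop
      (𝓝 (‖∑' k, X k • planeWaveLp L k‖ ^ 2)) :=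
    ((summable_smul_planeWaveLp hX).hasSum.norm).pow 2
  refine le_of_tendsto h1 (Eventually.of_forall fun s => ?_)
  have h2 := (orthonormal_planeWaveLp (L := L)).orthogonalFamily.norm_sum X s
  simp only [LinearIsometry.toSpanSingleton_apply] at h2
  rw [h2]
  exact hX.sum_le_tsum _ fun k _ => sq_nonneg _

theorem summable_norm_mode_sq (φ : Omega L) : Summable fun k => ‖mode L φ k‖ ^ 2 := by
  simp_rw [mode_eq_inner]
  exact orthonormal_planeWaveLp.inner_products_summable _

theorem tsum_norm_mode_sq_le (φ : Omega L) : ∑' k, ‖mode L φ k‖ ^ 2 ≤ norm_q 2 φ ^ 2 := by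
  simp_rw [mode_eq_inner]
  rw [← norm_toLp_eq]
  exact orthonormal_planeWaveLp.tsum_inner_products_le _

/-- Along a subsequence where the functional stays below `K`, the partial sums satisfy a common
oscillation bound and converge in `L²`. They are thus uniformly Cauchy, and the limit keeps both the
modes and the bound. -/
theorem exists_mode_eq {c σ K : ℝ} {X : ℤ → ℂ} (hc : 0 < c) (hσ : 0 < σ)
    (hX : Summable fun k => ‖X k‖ ^ 2)
    (hK : ∃ᶠ N in atTop, expIncr c σ (partialSum L N X) ≤ ENNReal.ofReal K) :
    ∃ φ : Omega L, mode L φ = X ∧ expIncr c σ φ ≤ ENNReal.ofReal K := by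
  have hL : 0 < L := Fact.out
  obtain ⟨n, hn, hnK⟩ := extraction_of_frequently_atTop hK
  obtain ⟨C, hC, hsup⟩ := norm_apply_le_of_expIncr_le (L := L) hc (half_pos hσ) (half_lt_self hσ)
  -- Any `H ≥ 1` with `K ≤ exp (H²)` would do.
  set H := 1 + |K| with hH
  have hH1 : 1 ≤ H := by simp [hH]
  have hKH : ENNReal.ofReal K ≤ ENNReal.ofReal (Real.exp (H ^ 2)) := by
    refine ENNReal.ofReal_le_ofReal ?_
    have h1 := Real.add_one_le_exp (H ^ 2)
    have h2 := le_abs_self K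
    nlinarith [abs_nonneg K]
  set f : ℕ → Omega L := fun j => partialSum L (n j) X with hf
  have hLp : CauchySeq fun j => ContinuousMap.toLp (E := ℂ) 2 (volume : Measure (AddCircle L)) ℂ (f j) := by
    have h1 := ((summable_smul_planeWaveLp (L := L) hX).hasSum.comp
      tendsto_Icc_neg_natCast_atTop).comp hn.tendsto_atTop
    refine Tendsto.cauchySeq (x := ∑' k, X k • planeWaveLp L k) (h1.congr fun j => ?_)
    simp only [hf, toLp_partialSum, Function.comp]
  have hcau : CauchySeq f := by
    refine Metric.cauchySeq_iff.2 fun ε hε => ?_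
    have hlim : Tendsto (fun h : ℝ => C * H * h ^ (σ / 2)) (𝓝 0) (𝓝 0) := by
      have h1 : Continuous fun h : ℝ => C * H * h ^ (σ / 2) :=
        continuous_const.mul (Real.continuous_rpow_const (half_pos hσ).le)
      have h2 := h1.tendsto 0
      rwa [Real.zero_rpow (half_pos hσ).ne', mul_zero] at h2
    have hev : ∀ᶠ h : ℝ in 𝓝[>] 0, C * H * h ^ (σ / 2) < ε / 4 ∧ 0 < h ∧ h ≤ L / 2 := by
      have h1 : ∀ᶠ h : ℝ in 𝓝[>] 0, C * H * h ^ (σ / 2) < ε / 4 :=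
        (hlim.eventually (gt_mem_nhds (by positivity))).filter_mono nhdsWithin_le_nhds
      have h2 : ∀ᶠ h : ℝ in 𝓝[>] 0, h ≤ L / 2 :=
        (ge_mem_nhds (by positivity : (0 : ℝ) < L / 2)).filter_mono nhdsWithin_le_nhds
      filter_upwards [h1, self_mem_nhdsWithin, h2] with h h3 h4 h5
      exact ⟨h3, h4, h5⟩
    obtain ⟨h, hh, h0, hhL⟩ := hev.exists
    have hs : 0 < Real.sqrt (2 * h) := Real.sqrt_pos.2 (by positivity)
    obtain ⟨N, hN⟩ := Metric.cauchySeq_iff.1 hLp (ε / 4 * Real.sqrt (2 * h)) (by positivity)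
    refine ⟨N, fun i hi j hj => ?_⟩
    have h1 := hN i hi j hj
    rw [dist_eq_norm, ← map_sub, norm_toLp_eq] at h1
    rw [dist_eq_norm]
    refine lt_of_le_of_lt ((ContinuousMap.norm_le _ (by positivity)).2 fun x => ?_) (half_lt_self hε)
    refine (hsup (f i) (f j) H hH1 ((hnK i).trans hKH) ((hnK j).trans hKH) x h h0 hhL).trans ?_
    have h2 : (Real.sqrt (2 * h))⁻¹ * norm_q 2 (f i - f j) ≤ ε / 4 := by
      rw [inv_mul_le_iff₀ hs]
      linarith
    linarith
  obtain ⟨φ, hφ⟩ := cauchySeq_tendsto_of_complete hcau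
  refine ⟨φ, ?_, expIncr_le_of_tendsto hφ hnK⟩
  funext k
  have h1 : Tendsto (fun j => mode L (f j) k) atTop (𝓝 (mode L φ k)) :=
    (((continuous_apply k).comp (continuous_mode L)).tendsto φ).comp hφ
  refine tendsto_nhds_unique h1 (tendsto_const_nhds.congr' ?_)
  filter_upwards [hn.tendsto_atTop.eventually_ge_atTop k.natAbs] with j hj
  refine (mode_partialSum X ?_).symm
  rw [Finset.mem_Icc]
  omega

/-- The partial sums of `φ` need not converge uniformly. A subsequence along which the functional is
bounded does converge to a continuous function, with the modes of `φ` and hence equal to it. -/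
theorem expIncr_le_liminf {c σ : ℝ} (hc : 0 < c) (hσ : 0 < σ) (φ : Omega L) :
    expIncr c σ φ ≤ liminf (fun N => expIncr c σ (partialSum L N (mode L φ))) atTop := by
  refine le_of_forall_gt_imp_ge_of_dense fun K hK => ?_
  rcases eq_or_ne K ∞ with rfl | hKt
  · exact le_top
  have h1 := frequently_lt_of_liminf_lt (by isBoundedDefault) hK
  obtain ⟨ψ, hψ, hψK⟩ := exists_mode_eq (K := K.toReal) hc hσ (summable_norm_mode_sq φ)
    (h1.mono fun N hN => by rw [ENNReal.ofReal_toReal hKt]; exact hN.le)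
  rw [ENNReal.ofReal_toReal hKt] at hψK
  rwa [injective_mode L hψ] at hψK

theorem ae_summable_modeLaw {m β s : ℝ} (hm : 0 < m) (hβ : 0 < β) (hs : s < 1 / 2) :
    ∀ᵐ X ∂(modeLaw L m β), Summable fun k : ℤ => eigenvalue L m k ^ s * ‖X k‖ ^ 2 := by
  obtain ⟨c, hc, hint⟩ := exists_lintegral_expModes_lt_top (L := L) hm hβ hs
  obtain ⟨C, -, hC⟩ := summable_and_tsum_le_of_expModes_le (L := L) hm hc hs
  filter_upwards [ae_lt_top (measurable_expModes m c s) hint.ne] with X hX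
  set K := (expModes L m c s X).toReal with hK
  refine (hC X (1 + K) (by simp [hK]) ?_).1
  rw [← ENNReal.ofReal_toReal hX.ne, ← hK]
  refine ENNReal.ofReal_le_ofReal ?_
  have h1 := Real.add_one_le_exp ((1 + K) ^ 2)
  nlinarith [show 0 ≤ K from ENNReal.toReal_nonneg]

variable (L) in
theorem isProbabilityMeasure_refMeasure {m β : ℝ} (hm : 0 < m) (hβ : 0 < β) :
    IsProbabilityMeasure (refMeasure L m β) := by
  have hP : IsProbabilityMeasure (modeLaw L m β) := by unfold modeLaw; infer_instance
  obtain ⟨c, hc, M, hM, hbound⟩ := exists_lintegral_expIncr_partialSum_le (L := L) hm hβ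
    (σ := 1 / 4) (by norm_num) (by norm_num)
  have hmeas : ∀ N : ℕ, Measurable fun X => expIncr c (1 / 4) (partialSum L N X) := fun N =>
    (measurable_expIncr c _).comp (continuous_partialSum N).measurable
  have hfin : ∫⁻ X, liminf (fun N => expIncr c (1 / 4) (partialSum L N X)) atTop
      ∂(modeLaw L m β) ≠ ∞ := by
    refine ne_top_of_le_ne_top hM ((lintegral_liminf_le hmeas).trans ?_)
    exact liminf_le_of_le (by isBoundedDefault) fun b hb =>
      let ⟨n, hn⟩ := hb.exists
      hn.trans (hbound n)
  have hrange : ∀ᵐ X ∂(modeLaw L m β), X ∈ range (mode L) := by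
    filter_upwards [ae_lt_top (Measurable.liminf hmeas) hfin,
      -- The exponent `s = 0` gives `∑ |X_k|² < ∞`, needed for convergence in `L²`.
      ae_summable_modeLaw (L := L) hm hβ (s := 0) (by norm_num)] with X hX hs
    obtain ⟨K, hK1, hK2⟩ := exists_between hX
    have h1 := frequently_lt_of_liminf_lt (by isBoundedDefault) hK1
    obtain ⟨φ, hφ, -⟩ := exists_mode_eq (σ := 1 / 4) (K := K.toReal) hc (by norm_num)
      (by simpa using hs)
      (h1.mono fun N hN => by rw [ENNReal.ofReal_toReal hK2.ne]; exact hN.le)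
    exact ⟨φ, hφ⟩
  refine ⟨?_⟩
  rw [refMeasure, (measurableEmbedding_mode L).comap_apply, image_univ]
  exact (prob_compl_eq_zero_iff (measurableEmbedding_mode L).measurableSet_range).1 hrange

theorem exists_lintegral_expIncr_lt_top {m β σ : ℝ} (hm : 0 < m) (hβ : 0 < β) (hσ0 : 0 < σ)
    (hσ : σ < 1 / 2) : ∃ c : ℝ, 0 < c ∧ ∫⁻ φ, expIncr c σ φ ∂(refMeasure L m β) < ∞ := by
  have := isProbabilityMeasure_refMeasure L hm hβ
  obtain ⟨c, hc, M, hM, hbound⟩ := exists_lintegral_expIncr_partialSum_le (L := L) hm hβ hσ0 hσ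
  refine ⟨c, hc, ?_⟩
  have hmeas : ∀ N : ℕ, Measurable fun X => expIncr c σ (partialSum L N X) := fun N =>
    (measurable_expIncr c _).comp (continuous_partialSum N).measurable
  calc ∫⁻ φ, expIncr c σ φ ∂(refMeasure L m β)
      ≤ ∫⁻ φ, liminf (fun N => expIncr c σ (partialSum L N (mode L φ))) atTop ∂(refMeasure L m β) :=
        lintegral_mono fun φ => expIncr_le_liminf hc hσ0 φ
    _ = ∫⁻ X, liminf (fun N => expIncr c σ (partialSum L N X)) atTop ∂(modeLaw L m β) := by
        rw [← map_mode_refMeasure L m β,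
          lintegral_map (Measurable.liminf hmeas) (continuous_mode L).measurable]
    _ ≤ liminf (fun N => ∫⁻ X, expIncr c σ (partialSum L N X) ∂(modeLaw L m β)) atTop :=
        lintegral_liminf_le hmeas
    _ ≤ M := liminf_le_of_le (by isBoundedDefault) fun b hb =>
        let ⟨n, hn⟩ := hb.exists
        hn.trans (hbound n)
    _ < ∞ := hM.lt_top

theorem exists_lintegral_expModes_mode_lt_top {m β s : ℝ} (hm : 0 < m) (hβ : 0 < β)
    (hs : s < 1 / 2) :
    ∃ c : ℝ, 0 < c ∧ ∫⁻ φ, expModes L m c s (mode L φ) ∂(refMeasure L m β) < ∞ := by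
  have := isProbabilityMeasure_refMeasure L hm hβ
  obtain ⟨c, hc, h⟩ := exists_lintegral_expModes_lt_top (L := L) hm hβ hs
  refine ⟨c, hc, ?_⟩
  rwa [← map_mode_refMeasure L m β,
    lintegral_map (measurable_expModes m c s) (continuous_mode L).measurable] at h

theorem ae_inDomain {m β γ : ℝ} (hm : 0 < m) (hβ : 0 < β) (hγ : γ < 1 / 4) :
    ∀ᵐ φ ∂(refMeasure L m β), InDomain m γ φ := by
  have := isProbabilityMeasure_refMeasure L hm hβ
  have h := ae_summable_modeLaw (L := L) hm hβ (s := 2 * γ) (by linarith)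
  rw [← map_mode_refMeasure L m β] at h
  exact ae_of_ae_map (continuous_mode L).measurable.aemeasurable h

end Reconstruction

/-! ### Young's inequality and the exponential integrability criterion -/

/-- Young's inequality for a product of subcritical powers. -/
theorem exists_mul_rpow_mul_rpow_le {a b s t K δ : ℝ} (ha : 0 ≤ a) (hb : 0 ≤ b) (hs : 0 < s)
    (ht : 0 < t) (hK : 0 < K) (hδ : 0 < δ) (hab : a / s + b / t < 1) :
    ∃ C : ℝ, ∀ x y : ℝ, 0 ≤ x → 0 ≤ y → K * (x ^ a * y ^ b) ≤ δ * (x ^ s + y ^ t) + C := by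
  set ρ := a / s + b / t with hρ
  have hρ0 : 0 ≤ ρ := by positivity
  have hρ1 : 0 < 1 - ρ := sub_pos.2 hab
  -- The product is at most `z^ρ` for `z = x^s + y^t`, and `z₀` is where `K z^ρ` equals `δ z`;
  -- beyond it the linear term wins.
  set z₀ := (K / δ) ^ (1 / (1 - ρ)) with hz₀
  have hz₀0 : 0 < z₀ := by positivity
  refine ⟨K * z₀ ^ ρ, fun x y hx hy => ?_⟩
  set z := x ^ s + y ^ t with hz
  have hz0 : 0 ≤ z := by positivity
  have h1 : x ^ a ≤ z ^ (a / s) := by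
    calc x ^ a = (x ^ s) ^ (a / s) := by
          rw [← Real.rpow_mul hx]
          congr 1
          field_simp
      _ ≤ z ^ (a / s) := Real.rpow_le_rpow (by positivity)
          (le_add_of_nonneg_right (by positivity)) (by positivity)
  have h2 : y ^ b ≤ z ^ (b / t) := by
    calc y ^ b = (y ^ t) ^ (b / t) := by
          rw [← Real.rpow_mul hy]
          congr 1
          field_simp
      _ ≤ z ^ (b / t) := Real.rpow_le_rpow (by positivity)
          (le_add_of_nonneg_left (by positivity)) (by positivity)
  have h3 : K * (x ^ a * y ^ b) ≤ K * z ^ ρ := by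
    rw [hρ, Real.rpow_add_of_nonneg hz0 (by positivity) (by positivity)]
    gcongr
  refine h3.trans ?_
  rcases le_or_gt z z₀ with h | h
  · have h4 : z ^ ρ ≤ z₀ ^ ρ := Real.rpow_le_rpow hz0 h hρ0
    have h5 : 0 ≤ δ * z := by positivity
    nlinarith
  · have hzp : 0 < z := hz₀0.trans h
    have h4 : K / δ ≤ z ^ (1 - ρ) := by
      calc K / δ = z₀ ^ (1 - ρ) := by
            rw [hz₀, ← Real.rpow_mul (by positivity), one_div, inv_mul_cancel₀ hρ1.ne',
              Real.rpow_one]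
        _ ≤ z ^ (1 - ρ) := Real.rpow_le_rpow hz₀0.le h.le hρ1.le
    rw [div_le_iff₀ hδ] at h4
    have h5 : z = z ^ (1 - ρ) * z ^ ρ := by
      rw [← Real.rpow_add hzp]
      simp
    have h6 : 0 ≤ K * z₀ ^ ρ := by positivity
    have h7 : 0 ≤ z ^ ρ := by positivity
    calc K * z ^ ρ ≤ z ^ (1 - ρ) * δ * z ^ ρ := by gcongr
      _ = δ * z := by
          conv_rhs => rw [h5]
          ring
      _ ≤ _ := by linarith

theorem integrable_exp_of_le_sq {Ω : Type*} [MeasurableSpace Ω] {μ : Measure Ω} [IsFiniteMeasure μ]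
    {G : Ω → ℝ} {B : Ω → ℝ≥0∞} {C : ℝ} (hG : AEStronglyMeasurable G μ) (hB : ∫⁻ ω, B ω ∂μ < ∞)
    (hGB : ∀ ω, ∀ H : ℝ, 1 ≤ H → B ω ≤ ENNReal.ofReal (Real.exp (H ^ 2)) → G ω ≤ H ^ 2 + C) :
    Integrable (fun ω => Real.exp (G ω)) μ := by
  refine ⟨Real.continuous_exp.comp_aestronglyMeasurable hG, ?_⟩
  rw [hasFiniteIntegral_iff_ofReal (ae_of_all _ fun ω => (Real.exp_pos _).le)]
  have hpt : ∀ ω, ENNReal.ofReal (Real.exp (G ω)) ≤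
      ENNReal.ofReal (Real.exp C) * (ENNReal.ofReal (Real.exp 1) + B ω) := by
    intro ω
    rcases eq_or_ne (B ω) ∞ with hω | hω
    · rw [hω, add_top, ENNReal.mul_top (by simp [Real.exp_pos])]
      exact le_top
    · set b := (B ω).toReal with hb
      have hb0 : 0 ≤ b := ENNReal.toReal_nonneg
      have hB' : B ω = ENNReal.ofReal b := (ENNReal.ofReal_toReal hω).symm
      have he := Real.exp_pos 1
      have hlog : 1 ≤ Real.log (Real.exp 1 + b) := by
        rw [Real.le_log_iff_exp_le (by positivity)]
        linarith
      have hH2 : Real.sqrt (Real.log (Real.exp 1 + b)) ^ 2 = Real.log (Real.exp 1 + b) :=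
        Real.sq_sqrt (by linarith)
      have h1 := hGB ω (Real.sqrt (Real.log (Real.exp 1 + b))) (Real.one_le_sqrt.2 hlog) (by
        rw [hH2, Real.exp_log (by positivity), hB']
        exact ENNReal.ofReal_le_ofReal (by linarith))
      rw [hH2] at h1
      rw [hB', ← ENNReal.ofReal_add he.le hb0, ← ENNReal.ofReal_mul (Real.exp_pos _).le]
      refine ENNReal.ofReal_le_ofReal ((Real.exp_le_exp.2 h1).trans (le_of_eq ?_))
      rw [Real.exp_add, Real.exp_log (by positivity), mul_comm]
  refine (lintegral_mono hpt).trans_lt ?_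
  rw [lintegral_const_mul' _ _ ENNReal.ofReal_ne_top, lintegral_add_left measurable_const,
    lintegral_const]
  exact ENNReal.mul_lt_top ENNReal.ofReal_lt_top
    (ENNReal.add_lt_top.2 ⟨ENNReal.mul_lt_top ENNReal.ofReal_lt_top (measure_lt_top _ _), hB⟩)

/-! ### Interpolation of the uniform norm and the `L^p` norms -/

section Interpolation

set_option linter.unusedSectionVars false

variable {L : ℝ} [Fact (0 < L)]

theorem norm_q_nonneg (q : ℝ) (f : Omega L) : 0 ≤ norm_q q f := lpNorm_nonneg

theorem eq_zero_of_norm_q_two_eq_zero {f : Omega L} (h : norm_q 2 f = 0) : f = 0 := by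
  rw [← norm_toLp_eq, norm_eq_zero] at h
  exact ContinuousMap.toLp_injective (p := 2) (𝕜 := ℂ) (volume : Measure (AddCircle L))
    (h.trans (map_zero _).symm)

/-- Interpolation of the uniform norm between Hölder regularity and `L²`. -/
theorem exists_norm_le_interpolation {c σ α : ℝ} (hc : 0 < c) (hα : 0 < α) (hασ : α < σ) :
    ∃ C : ℝ, 0 < C ∧ ∀ (f : Omega L) (H : ℝ), 1 ≤ H →
      expIncr c σ f ≤ ENNReal.ofReal (Real.exp (H ^ 2)) →
        ‖f‖ ≤ C * (H ^ (1 / (2 * α + 1)) * norm_q 2 f ^ (1 - 1 / (2 * α + 1)) + norm_q 2 f) := by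
  have hL : 0 < L := Fact.out
  obtain ⟨C, hC, hosc⟩ := norm_sub_setAverage_closedBall_le (L := L) hc hα hασ
  set θ := 1 / (2 * α + 1) with hθ
  have hθ0 : 0 < θ := by positivity
  have hθα : 2 * α * θ = 1 - θ := by
    rw [hθ]
    field_simp
    ring
  have hpt : ∀ (f : Omega L) (H : ℝ), 1 ≤ H → expIncr c σ f ≤ ENNReal.ofReal (Real.exp (H ^ 2)) →
      ∀ h : ℝ, 0 < h → h ≤ L / 2 → ‖f‖ ≤ C * H * h ^ α + h ^ (-(1 / 2) : ℝ) * norm_q 2 f := by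
    intro f H hH hB h h0 hhL
    have hn := norm_q_nonneg 2 f
    refine (ContinuousMap.norm_le _ (by positivity)).2 fun x => ?_
    have h1 := hosc f H hH hB x h h0 hhL
    have h2 := norm_setAverage_closedBall_le f x h0 hhL
    have h3 : (Real.sqrt (2 * h))⁻¹ ≤ h ^ (-(1 / 2) : ℝ) := by
      rw [Real.rpow_neg h0.le, ← Real.sqrt_eq_rpow]
      have := Real.sqrt_pos.2 h0
      gcongr
      linarith
    have h4 := norm_add_le (f x - ⨍ y in Metric.closedBall x h, f y)
      (⨍ y in Metric.closedBall x h, f y)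
    rw [sub_add_cancel] at h4
    nlinarith [mul_le_mul_of_nonneg_right h3 hn]
  set D := C * (L / 2) ^ (-(1 / (2 * θ))) * (L / 2) ^ α + (L / 2) ^ (-(1 / 2) : ℝ) with hD
  have hD0 : 0 < D := by positivity
  refine ⟨C + 1 + D, by positivity, fun f H hH hB => ?_⟩
  have hH0 : 0 < H := by linarith
  rcases (norm_q_nonneg 2 f).eq_or_lt with hn | hn
  · rw [eq_zero_of_norm_q_two_eq_zero hn.symm, norm_zero]
    have := norm_q_nonneg 2 (0 : Omega L)
    positivity
  set n := norm_q 2 f with hn_def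
  -- This scale balances `H h^α` against `h^{-1/2} n`; both become `H^θ n^{1-θ}`.
  set h := (n / H) ^ (2 * θ) with hh
  have h0 : 0 < h := by positivity
  have hI : 0 < H ^ θ * n ^ (1 - θ) := by positivity
  rcases le_or_gt h (L / 2) with hhL | hhL
  · have h1 := hpt f H hH hB h h0 hhL
    have h2 : H * h ^ α = H ^ θ * n ^ (1 - θ) := by
      rw [hh, ← Real.rpow_mul (by positivity), show 2 * θ * α = 1 - θ by linarith,
        Real.div_rpow hn.le hH0.le]
      have : H = H ^ θ * H ^ (1 - θ) := by rw [← Real.rpow_add hH0]; simp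
      have h3 : H ^ (1 - θ) ≠ 0 := by positivity
      field_simp
      rw [mul_comm, ← this]
    have h3 : h ^ (-(1 / 2) : ℝ) * n = H ^ θ * n ^ (1 - θ) := by
      rw [hh, ← Real.rpow_mul (by positivity), show 2 * θ * -(1 / 2) = -θ by ring,
        Real.rpow_neg (by positivity), Real.div_rpow hn.le hH0.le, inv_div,
        Real.rpow_sub hn, Real.rpow_one]
      ring
    rw [mul_assoc, h2, h3] at h1
    nlinarith [mul_pos hD0 hI, mul_pos hC hn, mul_pos hD0 hn]
  -- The optimal scale exceeds the circle, so `h = L/2` is used instead. Then `H` is at most a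
  -- multiple of `n`, and the summand `n` of the bound suffices.
  · have h1 := hpt f H hH hB (L / 2) (by positivity) le_rfl
    have h2 : H ≤ (L / 2) ^ (-(1 / (2 * θ))) * n := by
      have h3 : (L / 2) ^ (1 / (2 * θ)) ≤ n / H := by
        calc (L / 2) ^ (1 / (2 * θ)) ≤ h ^ (1 / (2 * θ)) :=
              Real.rpow_le_rpow (by positivity) hhL.le (by positivity)
          _ = n / H := by
              rw [hh, ← Real.rpow_mul (by positivity), mul_one_div_cancel (by positivity),
                Real.rpow_one]
      rw [le_div_iff₀ hH0] at h3
      rw [Real.rpow_neg (by positivity), inv_mul_eq_div, le_div_iff₀ (by positivity)]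
      linarith
    have h4 : C * H * (L / 2) ^ α ≤ C * ((L / 2) ^ (-(1 / (2 * θ))) * n) * (L / 2) ^ α := by
      gcongr
    have h5 : ‖f‖ ≤ D * n := by
      rw [hD]
      linarith
    nlinarith [mul_pos hD0 hI, mul_pos hC hn, mul_pos hC hI]

theorem exists_norm_rpow_le_interpolation {c σ α q : ℝ} (hc : 0 < c) (hα : 0 < α) (hασ : α < σ)
    (hq : 0 ≤ q) :
    ∃ C : ℝ, 0 < C ∧ ∀ (f : Omega L) (H : ℝ), 1 ≤ H →
      expIncr c σ f ≤ ENNReal.ofReal (Real.exp (H ^ 2)) →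
        ‖f‖ ^ q ≤ C * (H ^ (1 / (2 * α + 1) * q) * norm_q 2 f ^ ((1 - 1 / (2 * α + 1)) * q) +
          norm_q 2 f ^ q) := by
  obtain ⟨C, hC, hmain⟩ := exists_norm_le_interpolation (L := L) hc hα hασ
  refine ⟨C ^ q * 2 ^ q, by positivity, fun f H hH hB => ?_⟩
  have hn := norm_q_nonneg 2 f
  have hH0 : 0 ≤ H := by linarith
  set u := H ^ (1 / (2 * α + 1)) * norm_q 2 f ^ (1 - 1 / (2 * α + 1)) with hu
  have hu0 : 0 ≤ u := by positivity
  have h1 : (u + norm_q 2 f) ^ q ≤ 2 ^ q * (u ^ q + norm_q 2 f ^ q) := by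
    have h2 : u + norm_q 2 f ≤ 2 * max u (norm_q 2 f) := by
      linarith [le_max_left u (norm_q 2 f), le_max_right u (norm_q 2 f)]
    have h3 : (max u (norm_q 2 f)) ^ q ≤ u ^ q + norm_q 2 f ^ q := by
      rcases max_choice u (norm_q 2 f) with h | h <;> rw [h]
      · exact le_add_of_nonneg_right (by positivity)
      · exact le_add_of_nonneg_left (by positivity)
    calc (u + norm_q 2 f) ^ q ≤ (2 * max u (norm_q 2 f)) ^ q :=
          Real.rpow_le_rpow (by positivity) h2 hq
      _ = 2 ^ q * (max u (norm_q 2 f)) ^ q := Real.mul_rpow (by norm_num) (by positivity)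
      _ ≤ _ := by gcongr
  have h4 : u ^ q = H ^ (1 / (2 * α + 1) * q) * norm_q 2 f ^ ((1 - 1 / (2 * α + 1)) * q) := by
    rw [hu, Real.mul_rpow (by positivity) (by positivity), ← Real.rpow_mul hH0, ← Real.rpow_mul hn]
  calc ‖f‖ ^ q ≤ (C * (u + norm_q 2 f)) ^ q :=
        Real.rpow_le_rpow (norm_nonneg _) (hmain f H hH hB) hq
    _ = C ^ q * (u + norm_q 2 f) ^ q := Real.mul_rpow hC.le (by positivity)
    _ ≤ C ^ q * (2 ^ q * (u ^ q + norm_q 2 f ^ q)) := by gcongr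
    _ = _ := by rw [h4]; ring

theorem norm_q_rpow_eq {q : ℝ} (hq : 0 < q) (f : Omega L) :
    norm_q q f ^ q = ∫ x : AddCircle L, ‖f x‖ ^ q := by
  rw [norm_q, lpNorm_eq_integral_norm_rpow_toReal (by simpa using hq) (by simp)
    f.continuous.aestronglyMeasurable, ENNReal.toReal_ofReal hq.le, ← Real.rpow_mul (by positivity),
    inv_mul_cancel₀ hq.ne', Real.rpow_one]

theorem integrable_of_continuous {E : Type*} [NormedAddCommGroup E] {g : AddCircle L → E}
    (hg : Continuous g) : Integrable g volume :=
  hg.integrable_of_hasCompactSupport (HasCompactSupport.of_compactSpace g)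

theorem norm_q_rpow_le {p : ℝ} (hp : 2 < p) (f : Omega L) :
    norm_q p f ^ p ≤ ‖f‖ ^ (p - 2) * norm_q 2 f ^ 2 := by
  rw [norm_q_rpow_eq (by linarith), norm_q_two_sq, ← integral_const_mul]
  refine integral_mono (integrable_of_continuous ?_) (integrable_of_continuous ?_) fun x => ?_
  · exact f.continuous.norm.rpow_const fun x => Or.inr (by linarith)
  · exact continuous_const.mul (f.continuous.norm.pow 2)
  · have h1 : ‖f x‖ ^ p = ‖f x‖ ^ (p - 2) * ‖f x‖ ^ 2 := by
      rw [← Real.rpow_two, ← Real.rpow_add_of_nonneg (norm_nonneg _) (by linarith) (by norm_num)]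
      congr 1
      ring
    simp only
    rw [h1]
    gcongr
    exact f.norm_coe_le_norm x

theorem continuous_norm_q {q : ℝ} (hq : 1 ≤ q) : Continuous (norm_q (L := L) q) := by
  have : Fact (1 ≤ ENNReal.ofReal q) := ⟨by simpa using hq⟩
  have h : norm_q (L := L) q = fun f => ‖ContinuousMap.toLp (E := ℂ) (ENNReal.ofReal q)
      (volume : Measure (AddCircle L)) ℂ f‖ := by
    funext f
    rw [Lp.norm_def, norm_q, eLpNorm_congr_ae (ContinuousMap.coeFn_toLp volume f),
      toReal_eLpNorm f.continuous.aestronglyMeasurable]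
  rw [h]
  fun_prop

end Interpolation

/-! ### Arithmetic of the critical exponent -/

section Exponents

/-- After clearing denominators the difference is `(p - 2)²`. Hence the threshold on `r` also covers
the lower-order term `n^p`, which needs `p < 2r`. -/
theorem half_le_div {p α : ℝ} (hd : 0 < 4 * α + 4 - p) :
    p / 2 ≤ (2 * α * p + 2) / (4 * α + 4 - p) := by
  rw [div_le_div_iff₀ (by norm_num) hd]
  nlinarith [sq_nonneg (p - 2)]

theorem exponent_condition {p α r : ℝ} (hα : 0 < α) (hp : 2 < p) (hd : 0 < 4 * α + 4 - p)
    (hr : (2 * α * p + 2) / (4 * α + 4 - p) < r) :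
    1 / (2 * α + 1) * (p - 2) / 2 + ((1 - 1 / (2 * α + 1)) * (p - 2) + 2) / (2 * r) < 1 := by
  have hr0 : 0 < r := lt_trans (by positivity) hr
  rw [div_lt_iff₀ hd] at hr
  have h1 : 1 / (2 * α + 1) * (p - 2) / 2 + ((1 - 1 / (2 * α + 1)) * (p - 2) + 2) / (2 * r) =
      ((p - 2) * r + (2 * α * p + 2)) / ((2 * α + 1) * (2 * r)) := by
    field_simp
    ring
  rw [h1, div_lt_one (by positivity)]
  nlinarith

end Exponents

/-! ### Integrability for the `L^p` interaction -/

variable {L : ℝ} [Fact (0 < L)]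

theorem integrable_exp_norm_q_rpow {m β p lam κ α r : ℝ} (hm : 0 < m) (hβ : 0 < β) (hp : 2 < p)
    (hκ : 0 < κ) (hα0 : 0 < α) (hα : α < 1 / 2) (hd : 0 < 4 * α + 4 - p)
    (hr : (2 * α * p + 2) / (4 * α + 4 - p) < r) :
    Integrable (fun φ : Omega L =>
      Real.exp (lam / p * norm_q p φ ^ p - κ * norm_q 2 φ ^ (2 * r))) (refMeasure L m β) := by
  have := isProbabilityMeasure_refMeasure L hm hβ
  have hr0 : 0 < r := lt_trans (by positivity) hr
  -- The midpoint of `α` and `1/2`: room on one side for the oscillation bound, on the other for a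
  -- finite mean.
  set σ := (α + 1 / 2) / 2 with hσ
  obtain ⟨c, hc, hint⟩ := exists_lintegral_expIncr_lt_top (L := L) (σ := σ) hm hβ
    (by rw [hσ]; linarith) (by rw [hσ]; linarith)
  obtain ⟨C, hC, hsup⟩ := exists_norm_rpow_le_interpolation (L := L) (σ := σ) (q := p - 2) hc hα0
    (by rw [hσ]; linarith) (by linarith)
  set θ := 1 / (2 * α + 1) with hθ
  have hθ0 : 0 < θ := by positivity
  have hθ1 : θ < 1 := by
    rw [hθ, div_lt_one (by positivity)]
    linarith
  -- Young's inequality is used twice, so the total coefficient `2δ` must not exceed 1 on `H²` nor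
  -- `κ` on `n^{2r}`.
  set δ := min 1 κ / 2 with hδ
  have hδ0 : 0 < δ := by positivity
  set K := |lam| / p * C + 1 with hK
  have hK0 : 0 < K := by positivity
  have hb : 0 ≤ (1 - θ) * (p - 2) + 2 := by
    nlinarith
  obtain ⟨C₁, hC₁⟩ := exists_mul_rpow_mul_rpow_le (a := θ * (p - 2)) (b := (1 - θ) * (p - 2) + 2)
    (s := 2) (t := 2 * r) (by nlinarith) hb (by norm_num) (by positivity) hK0 hδ0
    (exponent_condition hα0 hp hd hr)
  obtain ⟨C₂, hC₂⟩ := exists_mul_rpow_mul_rpow_le (a := 0) (b := p)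
    (s := 2) (t := 2 * r) le_rfl (by linarith) (by norm_num) (by positivity) hK0 hδ0 (by
      have := (half_le_div hd).trans_lt hr
      rw [zero_div, zero_add, div_lt_one (by positivity)]
      linarith)
  refine integrable_exp_of_le_sq (B := expIncr c σ) (C := C₁ + C₂) ?_ hint fun φ H hH hB => ?_
  · refine Continuous.aestronglyMeasurable ?_
    refine (continuous_const.mul ((continuous_norm_q (by linarith)).rpow_const fun _ =>
      Or.inr (by linarith))).sub (continuous_const.mul
        ((continuous_norm_q (by norm_num)).rpow_const fun _ => Or.inr (by positivity)))
  · set n := norm_q 2 φ with hn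
    have hn0 : 0 ≤ n := norm_q_nonneg 2 φ
    have hH0 : 0 ≤ H := by linarith
    have h1 := hC₁ H n hH0 hn0
    have h2 := hC₂ H n hH0 hn0
    rw [Real.rpow_zero, one_mul] at h2
    rw [Real.rpow_two] at h1 h2
    have h3 : norm_q p φ ^ p ≤ C * (H ^ (θ * (p - 2)) * n ^ ((1 - θ) * (p - 2) + 2) + n ^ p) := by
      refine (norm_q_rpow_le hp φ).trans ?_
      calc ‖φ‖ ^ (p - 2) * n ^ 2
          ≤ C * (H ^ (θ * (p - 2)) * n ^ ((1 - θ) * (p - 2)) + n ^ (p - 2)) * n ^ 2 := by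
            gcongr
            exact hsup φ H hH hB
        _ = C * (H ^ (θ * (p - 2)) * (n ^ ((1 - θ) * (p - 2)) * n ^ (2 : ℝ)) +
              n ^ (p - 2) * n ^ (2 : ℝ)) := by
            rw [Real.rpow_two]
            ring
        _ = _ := by
            rw [← Real.rpow_add_of_nonneg hn0 (by nlinarith) (by norm_num),
              ← Real.rpow_add_of_nonneg hn0 (by linarith) (by norm_num), sub_add_cancel]
    set W := H ^ (θ * (p - 2)) * n ^ ((1 - θ) * (p - 2) + 2) + n ^ p with hW
    have hW0 : 0 ≤ W := by positivity
    have h4 : lam / p * norm_q p φ ^ p ≤ K * W := by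
      calc lam / p * norm_q p φ ^ p ≤ |lam| / p * norm_q p φ ^ p := by
            have := norm_q_nonneg p φ
            gcongr
            exact le_abs_self lam
        _ ≤ |lam| / p * (C * W) := by gcongr
        _ ≤ K * W := by
            rw [hK]
            linarith
    have h5 : K * W ≤ 2 * δ * (H ^ 2 + n ^ (2 * r)) + (C₁ + C₂) := by
      rw [hW, mul_add]
      linarith
    have h6 : 2 * δ * H ^ 2 ≤ 1 * H ^ 2 := by
      gcongr
      rw [hδ]
      linarith [min_le_left 1 κ]
    have h7 : 2 * δ * n ^ (2 * r) ≤ κ * n ^ (2 * r) := by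
      gcongr
      rw [hδ]
      linarith [min_le_right 1 κ]
    linarith

theorem isProbabilityMeasure_gibbsMeasure {m β p lam κ α r : ℝ} (hm : 0 < m) (hβ : 0 < β)
    (hp : 2 < p) (hκ : 0 < κ) (hα0 : 0 < α) (hα : α < 1 / 2) (hd : 0 < 4 * α + 4 - p)
    (hr : (2 * α * p + 2) / (4 * α + 4 - p) < r) :
    IsProbabilityMeasure (gibbsMeasure L m β p lam κ r) := by
  have := isProbabilityMeasure_refMeasure L hm hβ
  refine isProbabilityMeasure_tilted ?_
  have h := integrable_exp_norm_q_rpow (L := L) (lam := β * lam) hm hβ hp (mul_pos hβ hκ) hα0 hα hd hr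
  refine h.congr (ae_of_all _ fun φ => ?_)
  simp only
  congr 2
  ring

/-! ### Integrability for the pairing with the fractional power -/

/-- The cubic expression `|φ|² φ`. -/
def cubic (φ : Omega L) : Omega L := φ * star φ * φ

theorem quarticPairing_eq_inner (m γ : ℝ) (φ : Omega L) :
    quarticPairing m γ φ =
      inner ℂ (ContinuousMap.toLp (E := ℂ) 2 volume ℂ (cubic φ)) (fracPow m γ φ) := by
  rw [quarticPairing, L2.inner_def]
  refine integral_congr_ae ?_
  filter_upwards [ContinuousMap.coeFn_toLp (p := 2) (𝕜 := ℂ) (volume : Measure (AddCircle L)) (cubic φ)]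
    with x hx
  rw [hx, RCLike.inner_apply, cubic]
  simp only [ContinuousMap.mul_apply, ContinuousMap.star_apply, map_mul, RCLike.star_def,
    Complex.conj_conj]
  have : ((‖φ x‖ ^ 2 : ℝ) : ℂ) = φ x * conj (φ x) := by
    rw [Complex.mul_conj, Complex.normSq_eq_norm_sq]
  rw [this]
  ring

theorem norm_q_cubic_le (φ : Omega L) : norm_q 2 (cubic φ) ≤ ‖φ‖ ^ 2 * norm_q 2 φ := by
  have h : norm_q 2 (cubic φ) ^ 2 ≤ (‖φ‖ ^ 2 * norm_q 2 φ) ^ 2 := by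
    rw [mul_pow, norm_q_two_sq, norm_q_two_sq, ← integral_const_mul]
    refine integral_mono (integrable_of_continuous ((cubic φ).continuous.norm.pow 2))
      (integrable_of_continuous (continuous_const.mul (φ.continuous.norm.pow 2))) fun x => ?_
    have h1 : ‖cubic φ x‖ = ‖φ x‖ ^ 2 * ‖φ x‖ := by
      simp [cubic, pow_two]
    simp only
    rw [h1, mul_pow]
    gcongr
    exact φ.norm_coe_le_norm x
  exact le_of_sq_le_sq h (mul_nonneg (sq_nonneg _) (norm_q_nonneg 2 φ))

theorem summable_fracPow_coeff {m γ : ℝ} (hm : 0 < m) {φ : Omega L} (hφ : InDomain m γ φ) :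
    Summable fun k : ℤ => ‖((eigenvalue L m k ^ γ : ℝ) : ℂ) * mode L φ k‖ ^ 2 := by
  refine hφ.congr fun k => ?_
  have he := eigenvalue_pos L hm k
  rw [norm_mul, mul_pow, Complex.norm_real, Real.norm_of_nonneg (by positivity),
    ← Real.rpow_mul_natCast he.le]
  congr 2
  push_cast
  ring

theorem norm_fracPow_sq_le {m γ : ℝ} (hm : 0 < m) {φ : Omega L} (hφ : InDomain m γ φ) :
    ‖fracPow m γ φ‖ ^ 2 ≤ ∑' k : ℤ, eigenvalue L m k ^ (2 * γ) * ‖mode L φ k‖ ^ 2 := by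
  refine (norm_tsum_smul_planeWaveLp_sq_le (summable_fracPow_coeff hm hφ)).trans (le_of_eq ?_)
  refine tsum_congr fun k => ?_
  have he := eigenvalue_pos L hm k
  rw [norm_mul, mul_pow, Complex.norm_real, Real.norm_of_nonneg (by positivity),
    ← Real.rpow_mul_natCast he.le]
  congr 2
  push_cast
  ring

/-- Interpolation of the norm of `(m² - Δ)^γ φ` between `(m² - Δ)^{2γ} φ` and `φ`. -/
theorem inDomain_and_norm_fracPow_sq_le {m γ : ℝ} (hm : 0 < m) {φ : Omega L}
    (hφ : Summable fun k : ℤ => eigenvalue L m k ^ (4 * γ) * ‖mode L φ k‖ ^ 2) :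
    InDomain m γ φ ∧ ‖fracPow m γ φ‖ ^ 2 ≤
      Real.sqrt (∑' k : ℤ, eigenvalue L m k ^ (4 * γ) * ‖mode L φ k‖ ^ 2) * norm_q 2 φ := by
  have hpos : ∀ k, 0 ≤ eigenvalue L m k ^ (2 * γ) := fun k =>
    (Real.rpow_pos_of_pos (eigenvalue_pos L hm k) _).le
  have hsq : ∀ k, (eigenvalue L m k ^ (2 * γ) * ‖mode L φ k‖) ^ (2 : ℝ) =
      eigenvalue L m k ^ (4 * γ) * ‖mode L φ k‖ ^ 2 := by
    intro k
    rw [Real.rpow_two, mul_pow, ← Real.rpow_mul_natCast (eigenvalue_pos L hm k).le]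
    congr 2
    push_cast
    ring
  -- Cauchy–Schwarz on the factorisation `λ^{2γ} |X|² = (λ^{2γ} |X|) · |X|`.
  have h := Real.summable_and_inner_le_Lp_mul_Lq_tsum_of_nonneg (p := 2) (q := 2)
    (f := fun k : ℤ => eigenvalue L m k ^ (2 * γ) * ‖mode L φ k‖) (g := fun k : ℤ => ‖mode L φ k‖)
    Real.HolderConjugate.two_two (fun k => mul_nonneg (hpos k) (norm_nonneg _))
    (fun k => norm_nonneg _) (by simpa only [hsq] using hφ)
    (by simpa only [Real.rpow_two] using summable_norm_mode_sq φ)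
  simp only [hsq] at h
  simp only [Real.rpow_two, ← Real.sqrt_eq_rpow] at h
  have heq : ∀ k : ℤ, eigenvalue L m k ^ (2 * γ) * ‖mode L φ k‖ * ‖mode L φ k‖ =
      eigenvalue L m k ^ (2 * γ) * ‖mode L φ k‖ ^ 2 := fun k => by ring
  simp only [heq] at h
  refine ⟨h.1, (norm_fracPow_sq_le hm h.1).trans (h.2.trans ?_)⟩
  gcongr
  rw [← Real.sqrt_sq (norm_q_nonneg 2 φ)]
  exact Real.sqrt_le_sqrt (tsum_norm_mode_sq_le φ)

theorem continuous_cubic : Continuous (cubic (L := L)) := by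
  unfold cubic
  fun_prop

/-- Truncating the series of the fractional power gives continuous functionals of `φ`, which
converge to the pairing wherever `φ` lies in the domain. -/
theorem aestronglyMeasurable_quarticPairing {m β γ : ℝ} (hm : 0 < m) (hβ : 0 < β)
    (hγ : γ < 1 / 4) :
    AEStronglyMeasurable (quarticPairing (L := L) m γ) (refMeasure L m β) := by
  refine aestronglyMeasurable_of_tendsto_ae atTop (f := fun (N : ℕ) (φ : Omega L) =>
    inner ℂ (ContinuousMap.toLp (E := ℂ) 2 volume ℂ (cubic φ))
      (∑ k ∈ Finset.Icc (-(N : ℤ)) N, (((eigenvalue L m k ^ γ : ℝ) : ℂ) * mode L φ k) •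
        planeWaveLp L k)) (fun N => ?_) ?_
  · refine Continuous.aestronglyMeasurable ?_
    have h1 : ∀ k, Continuous fun φ : Omega L => mode L φ k := fun k =>
      (continuous_apply k).comp (continuous_mode L)
    have h2 := continuous_cubic (L := L)
    fun_prop
  · filter_upwards [ae_inDomain (L := L) hm hβ hγ] with φ hφ
    rw [quarticPairing_eq_inner]
    refine Tendsto.inner tendsto_const_nhds ?_
    exact (summable_smul_planeWaveLp (summable_fracPow_coeff hm hφ)).hasSum.comp
      tendsto_Icc_neg_natCast_atTop

theorem integrable_exp_norm_quarticPairing {m β γ μ κ r : ℝ} (hm : 0 < m) (hβ : 0 < β)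
    (hγ : γ < 1 / 8) (hκ : 0 < κ) (hr : 9 < r) :
    Integrable (fun φ : Omega L =>
      Real.exp (μ * ‖quarticPairing m γ φ‖ - κ * norm_q 2 φ ^ (2 * r))) (refMeasure L m β) := by
  have := isProbabilityMeasure_refMeasure L hm hβ
  obtain ⟨c, hc, hint⟩ := exists_lintegral_expIncr_lt_top (L := L) (σ := 7 / 16) hm hβ
    (by norm_num) (by norm_num)
  obtain ⟨c', hc', hint'⟩ := exists_lintegral_expModes_mode_lt_top (L := L) (s := 4 * γ) hm hβ
    (by linarith)
  -- With `α = 3/8` one has `θ = 4/7`, so `‖φ‖_∞²` is bounded through `H^{8/7} n^{6/7} + n²`. The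
  -- remaining factors contribute `H^{1/2} n^{3/2}`, whence the exponents `23/14, 33/14` and `1/2,
  -- 7/2` below. The first pair requires only `r > 33/5`, the second `r > 7/3`.
  obtain ⟨A, hA, hsup⟩ := exists_norm_rpow_le_interpolation (L := L) (σ := 7 / 16) (α := 3 / 8)
    (q := 2) hc (by norm_num) (by norm_num) (by norm_num)
  obtain ⟨D, hD, hspec⟩ := summable_and_tsum_le_of_expModes_le (L := L) (s := 4 * γ) hm hc'
    (by linarith)
  set δ := min 1 κ / 2 with hδ
  have hδ0 : 0 < δ := by positivity
  set E := D ^ (1 / 4 : ℝ) with hE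
  have hE0 : 0 < E := by positivity
  set K := |μ| * (A * E) + 1 with hK
  have hK0 : 0 < K := by positivity
  obtain ⟨C₁, hC₁⟩ := exists_mul_rpow_mul_rpow_le (a := 23 / 14) (b := 33 / 14)
    (s := 2) (t := 2 * r) (by norm_num) (by norm_num) (by norm_num) (by positivity) hK0 hδ0 (by
      have : (33 / 14 : ℝ) / (2 * r) < 5 / 28 := by
        rw [div_lt_iff₀ (by positivity)]
        linarith
      linarith)
  obtain ⟨C₂, hC₂⟩ := exists_mul_rpow_mul_rpow_le (a := 1 / 2) (b := 7 / 2)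
    (s := 2) (t := 2 * r) (by norm_num) (by norm_num) (by norm_num) (by positivity) hK0 hδ0 (by
      have : (7 / 2 : ℝ) / (2 * r) < 3 / 4 := by
        rw [div_lt_iff₀ (by positivity)]
        linarith
      linarith)
  -- The sum of the two functionals serves as `B`: a bound on it bounds each, with the same `H`.
  refine integrable_exp_of_le_sq (B := fun φ => expIncr c (7 / 16) φ + expModes L m c' (4 * γ) (mode L φ))
    (C := C₁ + C₂) ?_ ?_ fun φ H hH hB => ?_
  · refine ((aestronglyMeasurable_quarticPairing hm hβ (by linarith)).norm.const_mul μ).sub ?_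
    refine Continuous.aestronglyMeasurable ?_
    exact continuous_const.mul
      ((continuous_norm_q (by norm_num)).rpow_const fun _ => Or.inr (by positivity))
  · rw [lintegral_add_left (measurable_expIncr c _)]
    exact ENNReal.add_lt_top.2 ⟨hint, hint'⟩
  · have hB1 := (le_add_of_nonneg_right zero_le).trans hB
    have hB2 := (le_add_of_nonneg_left zero_le).trans hB
    have hsup := hsup φ H hH hB1
    obtain ⟨hs1, hs2⟩ := hspec (mode L φ) H hH hB2
    obtain ⟨-, hfrac⟩ := inDomain_and_norm_fracPow_sq_le hm hs1
    set n := norm_q 2 φ with hn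
    have hn0 : 0 ≤ n := norm_q_nonneg 2 φ
    have hH0 : 0 ≤ H := by linarith
    have h1 := hC₁ H n hH0 hn0
    have h2 := hC₂ H n hH0 hn0
    rw [Real.rpow_two] at h1 h2
    have hf : ‖fracPow m γ φ‖ ≤ E * (H ^ (1 / 2 : ℝ) * n ^ (1 / 2 : ℝ)) := by
      refine le_of_sq_le_sq (hfrac.trans ?_) (by positivity)
      have h3 : Real.sqrt (∑' k : ℤ, eigenvalue L m k ^ (4 * γ) * ‖mode L φ k‖ ^ 2) ≤
          Real.sqrt D * H := by
        calc _ ≤ Real.sqrt (D * H ^ 2) := Real.sqrt_le_sqrt hs2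
          _ = _ := by rw [Real.sqrt_mul hD.le, Real.sqrt_sq hH0]
      have h4 : E ^ 2 = Real.sqrt D := by
        rw [hE, ← Real.rpow_mul_natCast hD.le, Real.sqrt_eq_rpow]
        norm_num
      have h5 : ∀ y : ℝ, 0 ≤ y → (y ^ (1 / 2 : ℝ)) ^ 2 = y := fun y hy => by
        rw [← Real.sqrt_eq_rpow, Real.sq_sqrt hy]
      rw [mul_pow, mul_pow, h4, h5 H hH0, h5 n hn0, ← mul_assoc]
      gcongr
    set W := H ^ (23 / 14 : ℝ) * n ^ (33 / 14 : ℝ) + H ^ (1 / 2 : ℝ) * n ^ (7 / 2 : ℝ) with hW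
    have hW0 : 0 ≤ W := by positivity
    have hQ : ‖quarticPairing m γ φ‖ ≤ A * E * W := by
      rw [quarticPairing_eq_inner]
      refine (norm_inner_le_norm _ _).trans ?_
      rw [norm_toLp_eq]
      rw [Real.rpow_two] at hsup
      have e1 : (1 : ℝ) / (2 * (3 / 8) + 1) * 2 = 8 / 7 := by norm_num
      have e2 : (1 - (1 : ℝ) / (2 * (3 / 8) + 1)) * 2 = 6 / 7 := by norm_num
      rw [e1, e2] at hsup
      have hH' : H ^ (23 / 14 : ℝ) = H ^ (8 / 7 : ℝ) * H ^ (1 / 2 : ℝ) := by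
        rw [← Real.rpow_add_of_nonneg hH0 (by norm_num) (by norm_num)]
        norm_num
      have hn1 : n ^ (33 / 14 : ℝ) = n ^ (6 / 7 : ℝ) * n * n ^ (1 / 2 : ℝ) := by
        nth_rewrite 3 [← Real.rpow_one n]
        rw [← Real.rpow_add_of_nonneg hn0 (by norm_num) (by norm_num),
          ← Real.rpow_add_of_nonneg hn0 (by norm_num) (by norm_num)]
        norm_num
      have hn2 : n ^ (7 / 2 : ℝ) = n ^ (2 : ℝ) * n * n ^ (1 / 2 : ℝ) := by
        nth_rewrite 3 [← Real.rpow_one n]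
        rw [← Real.rpow_add_of_nonneg hn0 (by norm_num) (by norm_num),
          ← Real.rpow_add_of_nonneg hn0 (by norm_num) (by norm_num)]
        norm_num
      calc norm_q 2 (cubic φ) * ‖fracPow m γ φ‖
          ≤ (‖φ‖ ^ 2 * n) * (E * (H ^ (1 / 2 : ℝ) * n ^ (1 / 2 : ℝ))) := by
            gcongr
            exact norm_q_cubic_le φ
        _ ≤ (A * (H ^ (8 / 7 : ℝ) * n ^ (6 / 7 : ℝ) + n ^ (2 : ℝ)) * n) *
              (E * (H ^ (1 / 2 : ℝ) * n ^ (1 / 2 : ℝ))) := by gcongr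
        _ = A * E * W := by
            rw [hW, hH', hn1, hn2]
            ring
    have h4 : μ * ‖quarticPairing m γ φ‖ ≤ K * W := by
      calc μ * ‖quarticPairing m γ φ‖ ≤ |μ| * ‖quarticPairing m γ φ‖ := by
            gcongr
            exact le_abs_self μ
        _ ≤ |μ| * (A * E * W) := by gcongr
        _ ≤ K * W := by
            rw [hK]
            linarith
    have h5 : K * W ≤ 2 * δ * (H ^ 2 + n ^ (2 * r)) + (C₁ + C₂) := by
      rw [hW, mul_add]
      linarith
    have h6 : 2 * δ * H ^ 2 ≤ 1 * H ^ 2 := by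
      gcongr
      rw [hδ]
      linarith [min_le_left 1 κ]
    have h7 : 2 * δ * n ^ (2 * r) ≤ κ * n ^ (2 * r) := by
      gcongr
      rw [hδ]
      linarith [min_le_right 1 κ]
    linarith

end NLSGibbs

end

theorem theorem3p2 (L : ℝ) [Fact (0 < L)] (m β : ℝ) (hm : 0 < m) (hβ : 0 < β) :
    IsProbabilityMeasure (NLSGibbs.refMeasure L m β) ∧
    (∀ p lam κ α r : ℝ, 2 < p → p < 6 → 0 < κ → 0 < α → α < 1 / 2 → 0 < 4 * α + 4 - p →
      (2 * α * p + 2) / (4 * α + 4 - p) < r →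
        Integrable (fun φ : NLSGibbs.Omega L =>
          Real.exp (lam / p * NLSGibbs.norm_q p φ ^ p - κ * NLSGibbs.norm_q 2 φ ^ (2 * r)))
          (NLSGibbs.refMeasure L m β) ∧
        IsProbabilityMeasure (NLSGibbs.gibbsMeasure L m β p lam κ r)) ∧
    (∀ γ : ℝ, γ < 1 / 8 →
      (∀ᵐ φ ∂(NLSGibbs.refMeasure L m β), NLSGibbs.InDomain m γ φ) ∧
      ∀ μ κ r : ℝ, 0 < κ → 9 < r →
        Integrable (fun φ : NLSGibbs.Omega L =>
          Real.exp (μ * ‖NLSGibbs.quarticPairing m γ φ‖ - κ * NLSGibbs.norm_q 2 φ ^ (2 * r)))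
          (NLSGibbs.refMeasure L m β)) := by
  refine ⟨NLSGibbs.isProbabilityMeasure_refMeasure L hm hβ, ?_, ?_⟩
  · intro p lam κ α r hp _ hκ hα0 hα hd hr
    exact ⟨NLSGibbs.integrable_exp_norm_q_rpow hm hβ hp hκ hα0 hα hd hr,
      NLSGibbs.isProbabilityMeasure_gibbsMeasure hm hβ hp hκ hα0 hα hd hr⟩
  · intro γ hγ
    exact ⟨NLSGibbs.ae_inDomain hm hβ (by linarith), fun μ κ r hκ hr =>
      NLSGibbs.integrable_exp_norm_quarticPairing hm hβ hγ hκ hr⟩
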